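/- Let $\mathbb F_q$ be a finite field with $q$ elements, $A=\mathbb F_q[\theta]$, $K=\mathbb F_q(\theta)$, let $K_\infty$ be the completion of $K$ at the place $\infty$ and $\mathbb C_\infty$ the completion of an algebraic closure of $K_\infty$. The Carlitz module is the morphism of $\mathbb F_q$-algebras $a\mapsto C_a$, $A\to A[\tau]$, with $C_\theta=\theta+\tau$. For a commutative $A$-algebra $M$, let $C(M)$ denote $M$ with the $A$-module structure in which $a$ acts by $C_a$, where $\tau(m)=m^q$. Let $\Lambda_C\subset\mathbb C_\infty$ be the set of $A$-torsion points of $C(\mathbb C_\infty)$, and let $\mathfrak R=\bigcup_{s\ge1}\mathbb C_\infty[X_1,\dots,X_s]$. Write $C(\Lambda_C)\subset C(\mathfrak R)$ for the submodule of constant polynomials with value in $\Lambda_C$. Put $D_0=1$ and $D_i=(\theta^{q^i}-\theta)D_{i-1}^q$ for $i\ge1$, and let $\exp_C=\sum_{i\ge0}D_i^{-1}\tau^i$, acting on power series in $Z$ without constant term by $\tau(G)=G^q$. For $s\ge1$ let $$\mathbb S_s(X_1,\dots,X_s,Z)=\exp_C\Bigl(\sum_{k\ge0}Z^{q^k}\sum_{a\in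 A\text{ monic},\ \deg a=k}\frac{C_a(X_1)\cdots C_a(X_s)}{a}\Bigr)\in K[X_1,\dots,X_s][[Z]].$$ Theorem. For every $s\ge1$, $\mathbb S_s$ is a polynomial, with $\mathbb S_s\in A[X_1,\dots,X_s,Z]$, so that $\mathbb S_s(X_1,\dots,X_s,1)$ is defined. Let $\mathfrak F$ be the $A$-submodule of $C(\mathfrak R)$ generated by the polynomials $\mathbb S_s(X_1,\dots,X_s,1)$, $s\ge1$, and let $$\sqrt{\mathfrak F}=\{r\in\mathfrak R:\ C_a(r)\in\mathfrak F\text{ for some } a\in A\setminus\{0\}\}.$$ Then $\sqrt{\mathfrak F}=\mathfrak F+C(\Lambda_C)$. -/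

import Mathlib

open Polynomial
open scoped Pointwise

noncomputable section

/-! ### The field `ℂ_∞`

Throughout, `Fq` is a finite field with `q = Fintype.card Fq` elements, `A = Fq[X]` (its
indeterminate `X` is `θ`) and `K = RatFunc Fq`. -/

/-- `K_∞`, the completion of `K = 𝔽_q(θ)` at the place `∞`. -/
abbrev Kinf (Fq : Type*) [Field Fq] : Type _ :=
  @RatFunc.CompletionAtInfty Fq _ (Classical.decEq _)

namespace Kinf

open WithZero

theorem valuation_algebraMap (Fq : Type*) [Field Fq] (x : RatFunc Fq) :
    (Valued.v : Valuation (Kinf Fq) ℤᵐ⁰) (algebraMap (RatFunc Fq) (Kinf Fq) x) =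
      @RatFunc.inftyValuation Fq _ (Classical.decEq _) x := by
  classical
  let := RatFunc.inftyValued Fq
  exact Valued.valuedCompletion_apply x

theorem one_lt_card (Fq : Type*) [Field Fq] [Fintype Fq] :
    (1 : NNReal) < (Fintype.card Fq : NNReal) := by
  exact_mod_cast Fintype.one_lt_card (α := Fq)

/-- The valuation of `K_∞` as a valuation of rank one, normalized by `|θ| = q`. -/
instance rankOne (Fq : Type*) [Field Fq] [Fintype Fq] :
    Valuation.RankOne (Valued.v : Valuation (Kinf Fq) ℤᵐ⁰) where
  hom' := (WithZeroMulInt.toNNReal (one_lt_card Fq).ne_zero).comp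
    MonoidWithZeroHom.ValueGroup₀.embedding
  strictMono' := (WithZeroMulInt.toNNReal_strictMono (one_lt_card Fq)).comp
    MonoidWithZeroHom.ValueGroup₀.embedding_strictMono
  exists_val_nontrivial := by
    classical
    refine ⟨algebraMap (RatFunc Fq) (Kinf Fq) RatFunc.X, ?_⟩
    rw [valuation_algebraMap, RatFunc.inftyValuation.X]
    simp

instance (Fq : Type*) [Field Fq] [Fintype Fq] : NontriviallyNormedField (Kinf Fq) :=
  Valued.toNontriviallyNormedField (Kinf Fq) ℤᵐ⁰

instance (Fq : Type*) [Field Fq] [Fintype Fq] : IsUltrametricDist (Kinf Fq) :=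
  Valued.instIsUltrametricDist (Kinf Fq) ℤᵐ⁰

instance (Fq : Type*) [Field Fq] [Fintype Fq] : CompleteSpace (Kinf Fq) :=
  letI := @RatFunc.inftyValued Fq _ (Classical.decEq _)
  inferInstanceAs (CompleteSpace (UniformSpace.Completion (RatFunc Fq)))

end Kinf

/-- An algebraic closure of `K_∞`. -/
abbrev KinfBar (Fq : Type*) [Field Fq] : Type _ := AlgebraicClosure (Kinf Fq)

/-- The algebraic closure of `K_∞` carries the unique extension of the absolute value of `K_∞`. -/
instance KinfBar.normedField (Fq : Type*) [Field Fq] [Fintype Fq] : NormedField (KinfBar Fq) :=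
  spectralNorm.normedField (Kinf Fq) (KinfBar Fq)

/-- `ℂ_∞`, the completion of the algebraic closure of `K_∞`. -/
def Cinf (Fq : Type*) [Field Fq] [Fintype Fq] : Type _ := UniformSpace.Completion (KinfBar Fq)

namespace Cinf

variable (Fq : Type*) [Field Fq] [Fintype Fq]

instance : NormedField (Cinf Fq) :=
  inferInstanceAs (NormedField (UniformSpace.Completion (KinfBar Fq)))

/-- The inclusion of `K` in `ℂ_∞`. -/
def ofK : RatFunc Fq →+* Cinf Fq :=
  ((UniformSpace.Completion.coeRingHom : KinfBar Fq →+* UniformSpace.Completion (KinfBar Fq)).comp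
    (algebraMap (Kinf Fq) (KinfBar Fq))).comp (algebraMap (RatFunc Fq) (Kinf Fq))

instance : Algebra (RatFunc Fq) (Cinf Fq) := (ofK Fq).toAlgebra

instance : Algebra Fq (Cinf Fq) := ((ofK Fq).comp (algebraMap Fq (RatFunc Fq))).toAlgebra

/-- The element `θ` of `ℂ_∞`. -/
def theta : Cinf Fq := ofK Fq RatFunc.X

end Cinf

/-! ### The Carlitz module -/

section Carlitz

variable (Fq : Type*) [Field Fq] [Fintype Fq] {R : Type*} [CommRing R] [Algebra Fq R]

/-- For an `𝔽_q`-algebra `R` with a chosen element `t` (the image of `θ`), the `𝔽_q`-linear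
endomorphism `C_θ = θ + τ : x ↦ t x + x ^ q` of `R`. -/
def carlitzTheta (t : R) : Module.End Fq R :=
  LinearMap.mulLeft Fq t + (FiniteField.frobeniusAlgHom Fq R).toLinearMap

/-- The endomorphism `C_a` of `R`, for `a ∈ A`: the `𝔽_q`-algebra morphism `a ↦ C_a` is determined
by `C_θ = θ + τ`. -/
def carlitz (t : R) : Fq[X] →ₐ[Fq] Module.End Fq R := aeval (carlitzTheta Fq t)

/-- The `A`-module `C(R)`: the additive group of `R`, on which `a ∈ A` acts by `C_a`. The map
`Module.AEval'.of _ : R ≃ C(R)` is the identity. -/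
abbrev CarlitzModule (t : R) : Type _ := Module.AEval' (carlitzTheta Fq t)

theorem smul_carlitzModule_of (t : R) (a : Fq[X]) (x : R) :
    a • Module.AEval'.of (carlitzTheta Fq t) x =
      Module.AEval'.of (carlitzTheta Fq t) (carlitz Fq t a x) := rfl

end Carlitz

/-! ### The series `𝔏(F, Z)`

Here `L` is a field containing `𝔽_q` with a chosen element `t`, the image of `θ`. The variables
`X_1, X_2, …` are `MvPolynomial.X 0, MvPolynomial.X 1, …`. -/

section Series

variable (Fq : Type*) [Field Fq] [Fintype Fq] {L : Type*} [Field L] [Algebra Fq L] (t : L)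

/-- `D_0 = 1` and `D_i = (θ ^ (q ^ i) - θ) D_{i-1} ^ q`. -/
def carlitzD : ℕ → L
  | 0 => 1
  | i + 1 => (t ^ Fintype.card Fq ^ (i + 1) - t) * carlitzD i ^ Fintype.card Fq

theorem finite_monic (k : ℕ) : {a : Fq[X] | a.Monic ∧ a.natDegree = k}.Finite := by
  refine (Set.finite_range fun c : Fin (k + 1) → Fq => ∑ i, C (c i) * X ^ (i : ℕ)).subset ?_
  rintro a ⟨-, ha⟩
  refine ⟨fun i => a.coeff i, ?_⟩
  conv_rhs => rw [a.as_sum_range_C_mul_X_pow, ha]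
  exact Fin.sum_univ_eq_sum_range (fun i => C (a.coeff i) * X ^ i) (k + 1)

/-- `A_{+,k}`, the set of monic polynomials of degree `k`. -/
def monicOfDegree (k : ℕ) : Finset Fq[X] := (finite_monic Fq k).toFinset

/-- `a * F = F(C_a(X_1), C_a(X_2), …)`. -/
def starAction (a : Fq[X]) (F : MvPolynomial ℕ L) : MvPolynomial ℕ L :=
  MvPolynomial.aeval (fun j => carlitz Fq (MvPolynomial.C t) a (MvPolynomial.X j)) F

/-- `L_k(F) = ∑_{a ∈ A_{+,k}} (a * F) / a`. -/
def Lcoeff (F : MvPolynomial ℕ L) (k : ℕ) : MvPolynomial ℕ L :=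
  ∑ a ∈ monicOfDegree Fq k, MvPolynomial.C (aeval t a)⁻¹ * starAction Fq t a F

/-- `l(F, Z) = ∑_{k ≥ 0} L_k(F) Z ^ (q ^ k)`. -/
def lSeries (F : MvPolynomial ℕ L) : PowerSeries (MvPolynomial ℕ L) :=
  PowerSeries.mk fun n =>
    ∑ k ∈ Finset.range (n + 1), if Fintype.card Fq ^ k = n then Lcoeff Fq t F k else 0

/-- `exp_C(G) = ∑_{i ≥ 0} G ^ (q ^ i) / D_i` for a power series `G` in `Z` without constant term.
As `G ^ (q ^ i)` is divisible by `Z ^ (q ^ i)` and `q ^ i > i`, only the terms with `i ≤ n`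
contribute to the coefficient of `Z ^ n`. -/
def expC (G : PowerSeries (MvPolynomial ℕ L)) : PowerSeries (MvPolynomial ℕ L) :=
  PowerSeries.mk fun n =>
    ∑ i ∈ Finset.range (n + 1),
      MvPolynomial.C (carlitzD Fq t i)⁻¹ * PowerSeries.coeff n (G ^ Fintype.card Fq ^ i)

/-- `𝔏(F, Z) = exp_C(l(F, Z))`. -/
def logAlgSeries (F : MvPolynomial ℕ L) : PowerSeries (MvPolynomial ℕ L) :=
  expC Fq t (lSeries Fq t F)

/-- `𝕊_s(X_1, …, X_s, Z) = 𝔏(X_1 ⋯ X_s, Z)`, as a power series in `Z`. -/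
def specialSeries (s : ℕ) : PowerSeries (MvPolynomial ℕ L) :=
  logAlgSeries Fq t (∏ j ∈ Finset.range s, MvPolynomial.X j)

/-- `𝕊_s(X_1, …, X_s, 1)`, the sum of the coefficients of `𝕊_s(X_1, …, X_s, Z)`, which is a
polynomial in `Z`. -/
def specialPoly (s : ℕ) : MvPolynomial ℕ L :=
  ∑ᶠ n, PowerSeries.coeff n (specialSeries Fq t s)

end Series

/-! ### The module of special polynomials -/

section SpecialModule

variable (Fq : Type*) [Field Fq] [Fintype Fq]

/-- `C(ℜ)`, where `ℜ = ⋃_{s ≥ 1} ℂ_∞[X_1, …, X_s]` is the polynomial ring over `ℂ_∞` in the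
variables `X_1, X_2, …`. -/
abbrev CRing : Type _ :=
  CarlitzModule Fq (MvPolynomial.C (Cinf.theta Fq) : MvPolynomial ℕ (Cinf Fq))

/-- The identity map `ℜ → C(ℜ)`. -/
def toCRing : MvPolynomial ℕ (Cinf Fq) ≃ₗ[Fq] CRing Fq := Module.AEval'.of _

/-- `𝔉`, the sub-`A`-module of `C(ℜ)` generated by the `𝕊_s(X_1, …, X_s, 1)`, `s ≥ 1`. -/
def specialModule : Submodule Fq[X] (CRing Fq) :=
  Submodule.span Fq[X] {f | ∃ s : ℕ, 1 ≤ s ∧ f = toCRing Fq (specialPoly Fq (Cinf.theta Fq) s)}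

/-- `√𝔉`, the set of the `r ∈ ℜ` such that `C_a(r) ∈ 𝔉` for some nonzero `a ∈ A`. -/
def sqrtSpecialModule : Set (CRing Fq) :=
  {r | ∃ a : Fq[X], a ≠ 0 ∧ a • r ∈ specialModule Fq}

/-- `Λ_C`, the set of the `A`-torsion points of `C(ℂ_∞)`. -/
def torsionPoints : Set (Cinf Fq) :=
  {x | ∃ a : Fq[X], a ≠ 0 ∧ carlitz Fq (Cinf.theta Fq) a x = 0}

/-- `C(Λ_C)` as a subset of `C(ℜ)`: the constant polynomials with value in `Λ_C`. -/
def constTorsion : Set (CRing Fq) :=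
  (fun x => toCRing Fq (MvPolynomial.C x)) '' torsionPoints Fq

end SpecialModule

end

noncomputable section

/-! ### Coefficients of the Carlitz module -/

section CarlitzCoefficients

variable (Fq : Type*) [Field Fq] [Fintype Fq] {R : Type*} [CommRing R] [Algebra Fq R]

local notation "q" => Fintype.card Fq

/-! Write `𝕊_s = ∑ u_n Z ^ (q ^ n)` with `u_n = ∑_i D_i⁻¹ L_{n-i} ^ (q ^ i)` (`logAlgCoeff`).
Polynomiality is Anderson's log-algebraicity, proved in two steps. Integrality is checked at each
monic irreducible `P`: splitting the sums `L_k` according to whether `P ∣ a` and applying `exp_C`,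
which turns multiplication by `P` into `C_P`, gives a recursion for `P u_n`; since `C_P ≡ τ ^ deg P`
modulo `P`, it shows that `P u_n` is divisible by `P` (`logAlgCoeff_mem_range_map_local`). Vanishing
for `n > s` is a degree argument: in terms of the products of the `C_{θ ^ l}(X_j)`, the coefficients
of `u_n` lie in `A` and have negative degree, so they are zero (`logAlgCoeff_prod_X_eq_zero`).

For the radical, one inclusion is formal. For the other, let `C_a(r) = ∑ C_{c_i}(𝕊_{i+1})` with `a`
monic and the `𝕊` taken at `Z = 1`. The point is that `a` can be divided out of each term. Setting
the variables after the `(s+1)`-st to zero kills the later terms, so an induction on `s` reduces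
this to a single equation `C_a(r) = C_b(𝕊_{s+1})`.

If `s > 0` and `q - 1 ∣ s`, then `𝕊_{s+1} = 0`: power sums over polynomials make it divisible by
arbitrarily high powers of `X_1` (`specialPoly_eq_zero`). Otherwise `a ∣ b`
(`dvd_of_carlitz_eq_carlitz_specialPoly`): the derivative in `X_1` kills `q`-th powers, and at a
point with all coordinates `x`, where `x ^ (q - 1) = c - θ`, the derivative of `𝕊_{s+1}` is `x ^ s`.
Hence `a y = b x ^ s` with `y` integral over `A`; using `c = 0` and `c = 1` removes the factor `x ^
s`.

What is left of `r` after subtracting an element of `𝔉` is killed by `C_a`; comparing total degrees,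
it is a constant, hence a torsion point. -/

theorem card_field_pos : 0 < q := Fintype.card_pos

variable (R) in
/-- The `𝔽_q`-algebra endomorphism `x ↦ x ^ (q ^ i)`. -/
def frobPow (i : ℕ) : R →ₐ[Fq] R := FiniteField.frobeniusAlgHom Fq R ^ i

@[simp]
theorem frobPow_apply (i : ℕ) (x : R) : frobPow Fq R i x = x ^ q ^ i := by
  induction i generalizing x with
  | zero => simp [frobPow]
  | succ i ih =>
    rw [frobPow, pow_succ, AlgHom.mul_apply]
    change frobPow Fq R i (x ^ q) = _
    rw [ih, ← pow_mul, pow_succ']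

theorem add_pow_card_pow (i : ℕ) (x y : R) : (x + y) ^ q ^ i = x ^ q ^ i + y ^ q ^ i := by
  simpa using map_add (frobPow Fq R i) x y

theorem sub_pow_card_pow (i : ℕ) (x y : R) : (x - y) ^ q ^ i = x ^ q ^ i - y ^ q ^ i := by
  simpa using map_sub (frobPow Fq R i) x y

theorem sum_pow_card_pow {ι : Type*} (s : Finset ι) (f : ι → R) (i : ℕ) :
    (∑ j ∈ s, f j) ^ q ^ i = ∑ j ∈ s, f j ^ q ^ i := by
  simp only [← frobPow_apply, map_sum]

theorem smul_pow_card_pow (i : ℕ) (c : Fq) (x : R) : (c • x) ^ q ^ i = c • x ^ q ^ i := by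
  simp only [← frobPow_apply, map_smul]

theorem add_pow_card (x y : R) : (x + y) ^ q = x ^ q + y ^ q := by
  simpa using add_pow_card_pow Fq 1 x y

theorem sum_pow_card {ι : Type*} (s : Finset ι) (f : ι → R) :
    (∑ j ∈ s, f j) ^ q = ∑ j ∈ s, f j ^ q := by
  simpa using sum_pow_card_pow Fq s f 1

theorem smul_pow_card (c : Fq) (x : R) : (c • x) ^ q = c • x ^ q := by
  simpa using smul_pow_card_pow Fq 1 c x

omit [Fintype Fq] in
variable {Fq} in
theorem polynomial_induction_X_mul {p : Fq[X] → Prop} (one : p 1)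
    (add : ∀ a b, p a → p b → p (a + b)) (smul : ∀ (c : Fq) a, p a → p (c • a))
    (X_mul : ∀ a, p a → p (X * a)) (a : Fq[X]) : p a := by
  induction a using Polynomial.induction_on' with
  | add a b ha hb => exact add a b ha hb
  | monomial n c =>
    rw [← mul_one c, ← smul_eq_mul, ← smul_monomial]
    refine smul _ _ ?_
    induction n with
    | zero => simpa using one
    | succ n ih =>
      rw [← X_mul_monomial]
      exact X_mul _ ih

/-- Left multiplication by `t + τ` on twisted power series `∑ x_n τ ^ n`. -/
def twistedTheta (t : R) : Module.End Fq (ℕ → R) where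
  toFun x n := t * x n + n.casesOn 0 (fun k => x k ^ q)
  map_add' x y := by
    ext n
    cases n with
    | zero => simp [mul_add]
    | succ n => simp only [Pi.add_apply, add_pow_card]; ring
  map_smul' c x := by
    ext n
    cases n with
    | zero => simp
    | succ n => simp [smul_pow_card]

theorem twistedTheta_zero (t : R) (x : ℕ → R) : twistedTheta Fq t x 0 = t * x 0 := by
  simp [twistedTheta]

theorem twistedTheta_succ (t : R) (x : ℕ → R) (n : ℕ) :
    twistedTheta Fq t x (n + 1) = t * x (n + 1) + x n ^ q := by
  simp [twistedTheta]

variable {Fq}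

/-- The coefficient of `τ ^ j` in `C_a`. -/
def carlitzCoeff (a : Fq[X]) (j : ℕ) : Fq[X] :=
  aeval (twistedTheta Fq (X : Fq[X])) a (Pi.single 0 1) j

theorem carlitzCoeff_one (j : ℕ) : carlitzCoeff (1 : Fq[X]) j = if j = 0 then 1 else 0 := by
  simp [carlitzCoeff, Pi.single_apply]

theorem carlitzCoeff_add (a b : Fq[X]) (j : ℕ) :
    carlitzCoeff (a + b) j = carlitzCoeff a j + carlitzCoeff b j := by
  simp [carlitzCoeff]

theorem carlitzCoeff_smul (c : Fq) (a : Fq[X]) (j : ℕ) :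
    carlitzCoeff (c • a) j = c • carlitzCoeff a j := by
  simp [carlitzCoeff]

theorem carlitzCoeff_X_mul_zero (a : Fq[X]) :
    carlitzCoeff (X * a) 0 = X * carlitzCoeff a 0 := by
  simp [carlitzCoeff, twistedTheta_zero]

theorem carlitzCoeff_X_mul_succ (a : Fq[X]) (j : ℕ) :
    carlitzCoeff (X * a) (j + 1) = X * carlitzCoeff a (j + 1) + carlitzCoeff a j ^ q := by
  simp [carlitzCoeff, twistedTheta_succ]

theorem carlitzCoeff_zero (a : Fq[X]) : carlitzCoeff a 0 = a := by
  induction a using polynomial_induction_X_mul with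
  | one => simp [carlitzCoeff_one]
  | add a b ha hb => rw [carlitzCoeff_add, ha, hb]
  | smul c a ha => rw [carlitzCoeff_smul, ha]
  | X_mul a ha => rw [carlitzCoeff_X_mul_zero, ha]

/-- `C_{θa}` is both `C_θ C_a` and `C_a C_θ`; the definition reads off coefficients from the first
product, this recursion from the second. Comparing the two determines all coefficients from the
constant one. -/
theorem carlitzCoeff_X_mul_succ' (a : Fq[X]) (j : ℕ) :
    carlitzCoeff (X * a) (j + 1) =
      X ^ q ^ (j + 1) * carlitzCoeff a (j + 1) + carlitzCoeff a j := by
  induction a using polynomial_induction_X_mul generalizing j with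
  | one =>
    rw [carlitzCoeff_X_mul_succ]
    cases j <;> simp [carlitzCoeff_one, (card_field_pos Fq).ne']
  | add a b ha hb =>
    rw [mul_add, carlitzCoeff_add, ha, hb, carlitzCoeff_add, carlitzCoeff_add]
    ring
  | smul c a ha =>
    rw [mul_smul_comm, carlitzCoeff_smul, ha, carlitzCoeff_smul, carlitzCoeff_smul, smul_add,
      mul_smul_comm]
  | X_mul a ha =>
    rw [carlitzCoeff_X_mul_succ (X * a)]
    have h := carlitzCoeff_X_mul_succ a j
    cases j with
    | zero =>
      have h' := ha 0
      rw [carlitzCoeff_X_mul_zero, mul_pow]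
      simp only [zero_add, pow_one] at h h' ⊢
      linear_combination X * h' - X ^ q * h
    | succ j =>
      have h' : carlitzCoeff (X * a) (j + 1) ^ q =
          X ^ q ^ (j + 2) * carlitzCoeff a (j + 1) ^ q + carlitzCoeff a j ^ q := by
        rw [ha, add_pow_card, mul_pow, ← pow_mul, ← pow_succ]
      rw [h', carlitzCoeff_X_mul_succ a j]
      linear_combination X * ha (j + 1) - X ^ q ^ (j + 2) * h

theorem sub_mul_carlitzCoeff_succ (a : Fq[X]) (j : ℕ) :
    (X ^ q ^ (j + 1) - X) * carlitzCoeff a (j + 1) = carlitzCoeff a j ^ q - carlitzCoeff a j := by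
  have h := carlitzCoeff_X_mul_succ' a j
  rw [carlitzCoeff_X_mul_succ] at h
  linear_combination -h

theorem carlitzCoeff_sum {ι : Type*} (s : Finset ι) (f : ι → Fq[X]) (j : ℕ) :
    carlitzCoeff (∑ i ∈ s, f i) j = ∑ i ∈ s, carlitzCoeff (f i) j := by
  simp [carlitzCoeff]

theorem carlitzCoeff_X_pow_of_lt {k j : ℕ} (h : k < j) : carlitzCoeff (X ^ k : Fq[X]) j = 0 := by
  induction k generalizing j with
  | zero => simp [carlitzCoeff_one, h.ne']
  | succ k ih =>
    obtain ⟨j, rfl⟩ := Nat.exists_eq_succ_of_ne_zero (Nat.ne_zero_of_lt h)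
    rw [pow_succ', carlitzCoeff_X_mul_succ, ih (by omega), ih (by omega),
      zero_pow (card_field_pos Fq).ne', mul_zero, add_zero]

theorem carlitzCoeff_X_pow_self (k : ℕ) : carlitzCoeff (X ^ k : Fq[X]) k = 1 := by
  induction k with
  | zero => simp [carlitzCoeff_one]
  | succ k ih =>
    rw [pow_succ', carlitzCoeff_X_mul_succ, ih, carlitzCoeff_X_pow_of_lt (by omega)]
    simp

theorem carlitzCoeff_eq_sum (a : Fq[X]) (j : ℕ) :
    carlitzCoeff a j =
      ∑ k ∈ Finset.range (a.natDegree + 1), a.coeff k • carlitzCoeff (X ^ k : Fq[X]) j := by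
  conv_lhs => rw [a.as_sum_range_C_mul_X_pow]
  rw [carlitzCoeff_sum]
  exact Finset.sum_congr rfl fun k _ => by rw [← smul_eq_C_mul, carlitzCoeff_smul]

theorem carlitzCoeff_of_natDegree_lt {a : Fq[X]} {j : ℕ} (h : a.natDegree < j) :
    carlitzCoeff a j = 0 := by
  rw [carlitzCoeff_eq_sum]
  refine Finset.sum_eq_zero fun k hk => ?_
  rw [carlitzCoeff_X_pow_of_lt (by simp at hk; omega), smul_zero]

theorem carlitzCoeff_natDegree (a : Fq[X]) :
    carlitzCoeff a a.natDegree = C a.leadingCoeff := by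
  rw [carlitzCoeff_eq_sum, Finset.sum_range_succ, Finset.sum_eq_zero, carlitzCoeff_X_pow_self,
    zero_add, smul_eq_C_mul, mul_one, leadingCoeff]
  intro k hk
  rw [carlitzCoeff_X_pow_of_lt (by simpa using hk), smul_zero]

theorem carlitzTheta_apply (t x : R) : carlitzTheta Fq t x = t * x + x ^ q := rfl

theorem carlitz_X_mul (t x : R) (a : Fq[X]) :
    carlitz Fq t (X * a) x = t * carlitz Fq t a x + carlitz Fq t a x ^ q := by
  simp [carlitz, carlitzTheta_apply]

theorem carlitz_mul (t x : R) (a b : Fq[X]) :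
    carlitz Fq t (a * b) x = carlitz Fq t a (carlitz Fq t b x) := by simp

theorem carlitz_apply_of_lt (t x : R) {a : Fq[X]} {N : ℕ} (hN : a.natDegree < N) :
    carlitz Fq t a x = ∑ j ∈ Finset.range N, aeval t (carlitzCoeff a j) * x ^ q ^ j := by
  -- Allowing every large `N` avoids following the degree of `a` through the induction; the
  -- superfluous terms vanish anyway.
  have key : ∃ N₀, ∀ N ≥ N₀,
      carlitz Fq t a x = ∑ j ∈ Finset.range N, aeval t (carlitzCoeff a j) * x ^ q ^ j := by
    clear hN
    induction a using polynomial_induction_X_mul with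
    | one =>
      refine ⟨1, fun N hN => ?_⟩
      obtain ⟨N, rfl⟩ := Nat.exists_eq_add_of_le' hN
      simp [carlitzCoeff_one]
    | add a b ha hb =>
      obtain ⟨Na, ha⟩ := ha
      obtain ⟨Nb, hb⟩ := hb
      refine ⟨max Na Nb, fun N hN => ?_⟩
      rw [map_add, LinearMap.add_apply, ha N (le_trans (le_max_left _ _) hN),
        hb N (le_trans (le_max_right _ _) hN), ← Finset.sum_add_distrib]
      exact Finset.sum_congr rfl fun j _ => by rw [carlitzCoeff_add, map_add, add_mul]
    | smul c a ha =>
      obtain ⟨Na, ha⟩ := ha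
      refine ⟨Na, fun N hN => ?_⟩
      rw [map_smul, LinearMap.smul_apply, ha N hN, Finset.smul_sum]
      exact Finset.sum_congr rfl fun j _ => by rw [carlitzCoeff_smul, map_smul, smul_mul_assoc]
    | X_mul a ha =>
      obtain ⟨Na, ha⟩ := ha
      refine ⟨Na + 1, fun N hN => ?_⟩
      obtain ⟨N, rfl⟩ := Nat.exists_eq_add_of_le' (show 1 ≤ N by omega)
      rw [carlitz_X_mul]
      conv_lhs => rw [ha (N + 1) (by omega)]
      rw [← ha (N + 1) (by omega), ha N (by omega), sum_pow_card, Finset.sum_range_succ',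
        ← ha N (by omega), ha (N + 1) (by omega), Finset.sum_range_succ', mul_add,
        Finset.mul_sum, carlitzCoeff_X_mul_zero, add_right_comm, ← Finset.sum_add_distrib,
        map_mul, aeval_X, mul_assoc]
      congr 1
      refine Finset.sum_congr rfl fun j _ => ?_
      rw [carlitzCoeff_X_mul_succ, map_add, map_mul, map_pow, aeval_X, mul_pow, ← pow_mul,
        ← pow_succ]
      ring
  obtain ⟨N₀, h⟩ := key
  rw [h (max N₀ N) (le_max_left _ _)]
  refine (Finset.sum_subset (Finset.range_mono (le_max_right _ _)) fun j _ hj => ?_).symm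
  rw [carlitzCoeff_of_natDegree_lt (by simp at hj; omega), map_zero, zero_mul]

theorem carlitz_apply (t x : R) (a : Fq[X]) :
    carlitz Fq t a x =
      ∑ j ∈ Finset.range (a.natDegree + 1), aeval t (carlitzCoeff a j) * x ^ q ^ j :=
  carlitz_apply_of_lt t x (Nat.lt_succ_self _)

theorem map_carlitz {S : Type*} [CommRing S] [Algebra Fq S] (φ : R →ₐ[Fq] S) (t x : R)
    (a : Fq[X]) : φ (carlitz Fq t a x) = carlitz Fq (φ t) a (φ x) := by
  simp [carlitz_apply, aeval_algHom_apply]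

theorem aeval_twistedTheta_apply (t : R) (a : Fq[X]) (x : ℕ → R) (n : ℕ) :
    aeval (twistedTheta Fq t) a x n =
      ∑ j ∈ Finset.range (n + 1), aeval t (carlitzCoeff a j) * x (n - j) ^ q ^ j := by
  induction a using polynomial_induction_X_mul generalizing n with
  | one => simp [carlitzCoeff_one]
  | add a b ha hb =>
    rw [map_add, LinearMap.add_apply, Pi.add_apply, ha, hb, ← Finset.sum_add_distrib]
    exact Finset.sum_congr rfl fun j _ => by rw [carlitzCoeff_add, map_add, add_mul]
  | smul c a ha =>
    rw [map_smul, LinearMap.smul_apply, Pi.smul_apply, ha, Finset.smul_sum]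
    exact Finset.sum_congr rfl fun j _ => by rw [carlitzCoeff_smul, map_smul, smul_mul_assoc]
  | X_mul a ha =>
    rw [map_mul, aeval_X, Module.End.mul_apply]
    cases n with
    | zero => simp [twistedTheta_zero, ha, carlitzCoeff_X_mul_zero, mul_assoc]
    | succ n =>
      rw [twistedTheta_succ, ha, ha, sum_pow_card, Finset.sum_range_succ',
        Finset.sum_range_succ' _ (n + 1), mul_add, Finset.mul_sum, carlitzCoeff_X_mul_zero,
        add_right_comm, ← Finset.sum_add_distrib, map_mul, aeval_X, mul_assoc]
      congr 1
      refine Finset.sum_congr rfl fun j _ => ?_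
      rw [carlitzCoeff_X_mul_succ, map_add, map_mul, map_pow, aeval_X, mul_pow, ← pow_mul,
        ← pow_succ, Nat.add_sub_add_right]
      ring

end CarlitzCoefficients

/-! ### Arithmetic of `A` modulo an irreducible polynomial -/

section Residue

variable {Fq : Type*} [Field Fq] [Fintype Fq]

local notation "q" => Fintype.card Fq

theorem orderOf_frobeniusAlgHom_adjoinRoot {P : Fq[X]} [Fact (Irreducible P)] :
    orderOf (FiniteField.frobeniusAlgHom Fq (AdjoinRoot P)) = P.natDegree := by
  have hP : P ≠ 0 := (Fact.out : Irreducible P).ne_zero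
  have := (AdjoinRoot.powerBasis hP).finite
  have : Finite (AdjoinRoot P) := Module.finite_of_finite Fq
  rw [FiniteField.orderOf_frobeniusAlgHom, (AdjoinRoot.powerBasis hP).finrank,
    AdjoinRoot.powerBasis_dim]

theorem Irreducible.dvd_pow_card_pow_sub {P : Fq[X]} (hP : Irreducible P) (a : Fq[X]) :
    P ∣ a ^ q ^ P.natDegree - a := by
  have : Fact (Irreducible P) := ⟨hP⟩
  rw [← AdjoinRoot.mk_eq_mk, map_pow, ← frobPow_apply, frobPow,
    ← orderOf_frobeniusAlgHom_adjoinRoot, pow_orderOf_eq_one, AlgHom.one_apply]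

theorem Irreducible.natDegree_dvd_of_dvd_X_pow_sub_X {P : Fq[X]} (hP : Irreducible P) {j : ℕ}
    (h : P ∣ X ^ q ^ j - X) : P.natDegree ∣ j := by
  have : Fact (Irreducible P) := ⟨hP⟩
  rw [← orderOf_frobeniusAlgHom_adjoinRoot (P := P)]
  refine orderOf_dvd_of_pow_eq_one (AdjoinRoot.algHom_ext ?_)
  rw [← AdjoinRoot.mk_eq_mk, map_pow, AdjoinRoot.mk_X] at h
  exact (frobPow_apply Fq j _).trans h

theorem Irreducible.not_sq_dvd_X_pow_sub_X {P : Fq[X]} (hP : Irreducible P) (j : ℕ) :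
    ¬ P * P ∣ X ^ q ^ (j + 1) - X := by
  intro h
  obtain ⟨p, hp⟩ := CharP.exists Fq
  have hdvd : p ∣ q ^ (j + 1) :=
    ((CharP.cast_eq_zero_iff Fq p _).1 (FiniteField.cast_card_eq_zero Fq)).trans
      (dvd_pow_self _ (Nat.succ_ne_zero j))
  exact hP.not_isUnit ((galois_poly_separable p _ hdvd).squarefree P h)

/-- Together with the leading coefficient this says `C_P ≡ τ ^ deg P` modulo `P` for monic `P`. In
the recursion `sub_mul_carlitzCoeff_succ`, the factor `θ ^ (q ^ (j + 1)) - θ` is prime to `P` as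
long as `j + 1 < deg P`. -/
theorem Irreducible.dvd_carlitzCoeff {P : Fq[X]} (hP : Irreducible P) {j : ℕ}
    (hj : j < P.natDegree) : P ∣ carlitzCoeff P j := by
  induction j with
  | zero => rw [carlitzCoeff_zero]
  | succ j ih =>
    have h : P ∣ (X ^ q ^ (j + 1) - X) * carlitzCoeff P (j + 1) := by
      rw [sub_mul_carlitzCoeff_succ]
      have := ih (by omega)
      exact dvd_sub (dvd_pow this (card_field_pos Fq).ne') this
    refine (hP.prime.dvd_or_dvd h).resolve_left fun h' => ?_
    exact absurd (Nat.le_of_dvd (Nat.succ_pos j) (hP.natDegree_dvd_of_dvd_X_pow_sub_X h'))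
      (by omega)

end Residue

/-! ### The local ring of `A` at an irreducible polynomial -/

section LocalRing

variable {Fq : Type*} [Field Fq] [Fintype Fq] {L : Type*} [Field L] [Algebra Fq L] {t : L}

local notation "q" => Fintype.card Fq

/-- The local ring of `A` at `P`, embedded in `L` by `θ ↦ t`. -/
def localSubalgebra (t : L) {P : Fq[X]} (hP : Irreducible P) : Subalgebra Fq L where
  carrier := {x | ∃ a b : Fq[X], ¬ P ∣ b ∧ x * aeval t b = aeval t a}
  mul_mem' := by
    rintro x y ⟨a, b, hb, h⟩ ⟨c, d, hd, h'⟩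
    refine ⟨a * c, b * d, hP.prime.not_dvd_mul hb hd, ?_⟩
    rw [map_mul, map_mul, ← h, ← h']
    ring
  add_mem' := by
    rintro x y ⟨a, b, hb, h⟩ ⟨c, d, hd, h'⟩
    refine ⟨a * d + c * b, b * d, hP.prime.not_dvd_mul hb hd, ?_⟩
    rw [map_mul, map_add, map_mul, map_mul, ← h, ← h']
    ring
  algebraMap_mem' c := ⟨C c, 1, fun h => hP.not_isUnit (isUnit_of_dvd_one h), by simp⟩

omit [Fintype Fq] in
theorem aeval_mem_localSubalgebra {P : Fq[X]} (hP : Irreducible P) (a : Fq[X]) :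
    aeval t a ∈ localSubalgebra t hP :=
  ⟨a, 1, fun h => hP.not_isUnit (isUnit_of_dvd_one h), by simp⟩

variable (ht : Function.Injective (aeval t : Fq[X] →ₐ[Fq] L))

include ht

omit [Fintype Fq] in
theorem aeval_ne_zero_of_injective {a : Fq[X]} (ha : a ≠ 0) : aeval t a ≠ 0 :=
  (map_ne_zero_iff _ ht).2 ha

omit [Fintype Fq] in
theorem inv_aeval_mem_localSubalgebra {P : Fq[X]} (hP : Irreducible P) {b : Fq[X]}
    (hb : ¬ P ∣ b) : (aeval t b)⁻¹ ∈ localSubalgebra t hP :=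
  ⟨1, b, hb, by
    rw [map_one, inv_mul_cancel₀]
    exact aeval_ne_zero_of_injective ht (by rintro rfl; exact hb (dvd_zero P))⟩

theorem dvd_pow_card_pow_sub_localSubalgebra {P : Fq[X]} (hP : Irreducible P)
    (x : localSubalgebra t hP) :
    (⟨aeval t P, aeval_mem_localSubalgebra hP P⟩ : localSubalgebra t hP) ∣
      x ^ q ^ P.natDegree - x := by
  obtain ⟨x, a, b, hb, h⟩ := x
  set Q := q ^ P.natDegree
  obtain ⟨c, hc⟩ : P ∣ a ^ Q * b - a * b ^ Q := by
    have h1 := hP.dvd_pow_card_pow_sub a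
    have h2 := hP.dvd_pow_card_pow_sub b
    have : a ^ Q * b - a * b ^ Q = (a ^ Q - a) * b - a * (b ^ Q - b) := by ring
    rw [this]
    exact dvd_sub (h1.mul_right _) (h2.mul_left _)
  have hb0 : aeval t b ≠ 0 :=
    aeval_ne_zero_of_injective ht (by rintro rfl; exact hb (dvd_zero P))
  have hx : x = aeval t a * (aeval t b)⁻¹ := (eq_mul_inv_iff_mul_eq₀ hb0).2 h
  refine ⟨⟨_, mul_mem (aeval_mem_localSubalgebra hP c) (pow_mem
    (inv_aeval_mem_localSubalgebra ht hP hb) (Q + 1))⟩, Subtype.ext ?_⟩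
  change x ^ Q - x = aeval t P * (aeval t c * (aeval t b)⁻¹ ^ (Q + 1))
  have hc' := congrArg (aeval t) hc
  simp only [map_sub, map_mul, map_pow] at hc'
  rw [← mul_assoc, ← hc', hx, mul_pow, inv_pow, inv_pow]
  field_simp
  ring

/-- The polynomial `X ^ (q ^ (j + 1)) - X` is squarefree, so its valuation at `P` is at most one. -/
theorem X_pow_sub_X_dvd_local {P : Fq[X]} (hP : Irreducible P) (j : ℕ) :
    ∃ y ∈ localSubalgebra t hP, (t ^ q ^ (j + 1) - t) * y = aeval t P := by
  have hne : (X ^ q ^ (j + 1) - X : Fq[X]) ≠ 0 :=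
    fun h => hP.not_sq_dvd_X_pow_sub_X j (h ▸ dvd_zero _)
  have hne' := aeval_ne_zero_of_injective ht hne
  have haev : aeval t (X ^ q ^ (j + 1) - X : Fq[X]) = t ^ q ^ (j + 1) - t := by simp
  by_cases h : P ∣ X ^ q ^ (j + 1) - X
  · obtain ⟨b, hb⟩ := h
    have hPb : ¬ P ∣ b := fun ⟨c, hc⟩ => hP.not_sq_dvd_X_pow_sub_X j ⟨c, by rw [hb, hc, mul_assoc]⟩
    refine ⟨_, inv_aeval_mem_localSubalgebra ht hP hPb, ?_⟩
    rw [← haev, hb, map_mul, mul_assoc, mul_inv_cancel₀, mul_one]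
    intro h0
    rw [hb, map_mul, h0, mul_zero] at hne'
    exact hne' rfl
  · refine ⟨_, mul_mem (inv_aeval_mem_localSubalgebra ht hP h) (aeval_mem_localSubalgebra hP P), ?_⟩
    rw [← haev, mul_inv_cancel_left₀ hne']

/-- The valuation of `D_i` at `P` is at most `q ^ i - 1`, by induction from the recursion for `D_i`.
-/
theorem carlitzD_dvd_local {P : Fq[X]} (hP : Irreducible P) (i : ℕ) :
    ∃ y ∈ localSubalgebra t hP, carlitzD Fq t i * y = aeval t P ^ (q ^ i - 1) := by
  induction i with
  | zero => exact ⟨1, one_mem _, by simp [carlitzD]⟩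
  | succ i ih =>
    obtain ⟨y, hy, h⟩ := ih
    obtain ⟨z, hz, h'⟩ := X_pow_sub_X_dvd_local ht hP i
    have hq : 2 ≤ q := Fintype.one_lt_card
    have hi : 1 ≤ q ^ i := Nat.one_le_pow _ _ (by omega)
    -- The bound `1 + (q ^ i - 1) q` given by the recursion falls short of `q ^ (i + 1) - 1` by `e =
    -- q - 2`.
    obtain ⟨e, he⟩ : ∃ e, q ^ (i + 1) - 1 = 1 + (q ^ i - 1) * q + e := by
      refine ⟨q - 2, ?_⟩
      have : q ≤ q ^ i * q := Nat.le_mul_of_pos_left _ hi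
      rw [pow_succ, Nat.sub_mul, one_mul]
      omega
    refine ⟨z * y ^ q * aeval t P ^ e, mul_mem (mul_mem hz (pow_mem hy _))
      (pow_mem (aeval_mem_localSubalgebra hP P) _), ?_⟩
    rw [he, pow_add, pow_add, pow_mul, ← h, ← h', carlitzD]
    ring

theorem carlitzD_ne_zero (i : ℕ) : carlitzD Fq t i ≠ 0 := by
  obtain ⟨y, -, h⟩ := carlitzD_dvd_local ht irreducible_X i
  refine left_ne_zero_of_mul (h.trans_ne (pow_ne_zero _ ?_))
  exact aeval_ne_zero_of_injective ht X_ne_zero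

/-- This is why `exp_C` preserves divisibility by `P`: raising to the power `q ^ i` gains more than
`D_i` costs. -/
theorem pow_mul_inv_carlitzD_local {P : Fq[X]} (hP : Irreducible P) (i : ℕ) :
    ∃ y ∈ localSubalgebra t hP, aeval t P ^ q ^ i * (carlitzD Fq t i)⁻¹ = aeval t P * y := by
  obtain ⟨y, hy, h⟩ := carlitzD_dvd_local ht hP i
  refine ⟨y, hy, ?_⟩
  rw [← Nat.sub_add_cancel (Nat.one_le_pow i q (card_field_pos Fq)), pow_succ', ← h]
  have := carlitzD_ne_zero ht i
  field_simp

omit [Fintype Fq] ht in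
-- The ideal of denominators of `x` lies in no maximal ideal of `A`, so it contains `1`.
theorem mem_range_aeval_of_forall_local {x : L}
    (h : ∀ (P : Fq[X]) (hP : Irreducible P), P.Monic → x ∈ localSubalgebra t hP) :
    x ∈ (aeval t : Fq[X] →ₐ[Fq] L).range := by
  let I : Ideal Fq[X] :=
    { carrier := {b | ∃ a : Fq[X], x * aeval t b = aeval t a}
      add_mem' := by
        rintro b d ⟨a, h⟩ ⟨c, h'⟩
        exact ⟨a + c, by rw [map_add, mul_add, h, h', map_add]⟩
      zero_mem' := ⟨0, by simp⟩
      smul_mem' := by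
        rintro c b ⟨a, h⟩
        exact ⟨c * a, by rw [smul_eq_mul, map_mul, mul_left_comm, h, map_mul]⟩ }
  have hI : I = ⊤ := by
    by_contra hI
    obtain ⟨P, hPm, hP, hdvd⟩ := exists_monic_irreducible_factor (Submodule.IsPrincipal.generator I)
      fun hu => hI (by
        rw [← Submodule.IsPrincipal.span_singleton_generator I]
        exact Ideal.span_singleton_eq_top.2 hu)
    obtain ⟨a, b, hb, h⟩ := h P hP hPm
    exact hb (hdvd.trans ((Submodule.IsPrincipal.mem_iff_generator_dvd I).1 ⟨a, h⟩))
  obtain ⟨a, ha⟩ : (1 : Fq[X]) ∈ I := hI ▸ Submodule.mem_top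
  exact ⟨a, by simpa using ha.symm⟩

end LocalRing

/-! ### The coefficients of `𝔏(F, Z)` -/

section LogAlgCoeff

variable (Fq : Type*) [Field Fq] [Fintype Fq] {L : Type*} [Field L] [Algebra Fq L] (t : L)

local notation "q" => Fintype.card Fq

/-- `exp_C` as an operator on sequences: the coefficient of `τ ^ n` in
`(∑ D_i⁻¹ τ ^ i) (∑ x_k τ ^ k)`. -/
def expSeq : (ℕ → MvPolynomial ℕ L) →ₗ[Fq] (ℕ → MvPolynomial ℕ L) where
  toFun x n := ∑ i ∈ Finset.range (n + 1),
    MvPolynomial.C (carlitzD Fq t i)⁻¹ * x (n - i) ^ q ^ i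
  map_add' x y := by
    ext1 n
    simp only [Pi.add_apply, add_pow_card_pow, mul_add, Finset.sum_add_distrib]
  map_smul' c x := by
    ext1 n
    simp only [Pi.smul_apply, smul_pow_card_pow, mul_smul_comm, Finset.smul_sum, RingHom.id_apply]

theorem expSeq_apply (x : ℕ → MvPolynomial ℕ L) (n : ℕ) :
    expSeq Fq t x n = ∑ i ∈ Finset.range (n + 1),
      MvPolynomial.C (carlitzD Fq t i)⁻¹ * x (n - i) ^ q ^ i := rfl

/-- The coefficient of `Z ^ (q ^ n)` in `𝔏(F, Z)`. -/
def logAlgCoeff (F : MvPolynomial ℕ L) (n : ℕ) : MvPolynomial ℕ L :=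
  expSeq Fq t (Lcoeff Fq t F) n

variable {Fq t}

theorem map_expSeq (φ : MvPolynomial ℕ L →ₐ[L] MvPolynomial ℕ L) (x : ℕ → MvPolynomial ℕ L)
    (n : ℕ) : φ (expSeq Fq t x n) = expSeq Fq t (fun k => φ (x k)) n := by
  simp only [expSeq_apply, map_sum, map_mul, map_pow, ← MvPolynomial.algebraMap_eq,
    AlgHom.commutes]

/-- Right multiplication by `τ ^ d` commutes with left multiplication by `exp_C`. -/
theorem expSeq_shift (x : ℕ → MvPolynomial ℕ L) (d n : ℕ) :
    expSeq Fq t (fun k => if d ≤ k then x (k - d) else 0) n =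
      if d ≤ n then expSeq Fq t x (n - d) else 0 := by
  have h0 : ∀ i, (0 : MvPolynomial ℕ L) ^ q ^ i = 0 := fun i =>
    zero_pow (pow_pos (card_field_pos Fq) i).ne'
  split_ifs with h
  · rw [expSeq_apply, expSeq_apply]
    refine (Finset.sum_subset_zero_on_sdiff (Finset.range_mono (by omega)) ?_ ?_).symm
    · intro i hi
      simp only [Finset.mem_sdiff, Finset.mem_range] at hi
      rw [if_neg (by omega), h0, mul_zero]
    · intro i hi
      simp only [Finset.mem_range] at hi
      rw [if_pos (by omega), Nat.sub_right_comm]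
  · rw [expSeq_apply]
    refine Finset.sum_eq_zero fun i hi => ?_
    rw [if_neg (by omega), h0, mul_zero]

/-- The functional equation `exp_C θ = C_θ exp_C`; coefficient by coefficient it is the recursion
defining `D_i`. -/
theorem expSeq_C_theta_mul (ht : Function.Injective (aeval t : Fq[X] →ₐ[Fq] L))
    (y : ℕ → MvPolynomial ℕ L) :
    expSeq Fq t (fun k => MvPolynomial.C t * y k) =
      twistedTheta Fq (MvPolynomial.C t) (expSeq Fq t y) := by
  ext1 n
  cases n with
  | zero => simp [twistedTheta_zero, expSeq_apply, carlitzD]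
  | succ n =>
    rw [twistedTheta_succ, expSeq_apply, expSeq_apply, expSeq_apply, sum_pow_card,
      Finset.sum_range_succ', Finset.sum_range_succ' _ (n + 1), mul_add, add_right_comm,
      Finset.mul_sum, ← Finset.sum_add_distrib]
    congr 1
    · refine Finset.sum_congr rfl fun i _ => ?_
      have hne : t ^ q ^ (i + 1) - t ≠ 0 := by
        have := carlitzD_ne_zero ht (i + 1)
        rw [carlitzD] at this
        exact left_ne_zero_of_mul this
      have hD := carlitzD_ne_zero ht i
      rw [Nat.add_sub_add_right, mul_pow, mul_pow, ← pow_mul, ← pow_succ, ← map_pow, ← map_pow,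
        ← mul_assoc, ← mul_assoc, ← add_mul, ← map_mul, ← map_mul, ← map_add]
      congr 2
      rw [carlitzD, inv_pow]
      field_simp
      ring
    · simp [carlitzD]

theorem expSeq_C_mul (ht : Function.Injective (aeval t : Fq[X] →ₐ[Fq] L)) (a : Fq[X])
    (x : ℕ → MvPolynomial ℕ L) (n : ℕ) :
    expSeq Fq t (fun k => MvPolynomial.C (aeval t a) * x k) n =
      ∑ j ∈ Finset.range (n + 1),
        MvPolynomial.C (aeval t (carlitzCoeff a j)) * expSeq Fq t x (n - j) ^ q ^ j := by
  have hC : ∀ b : Fq[X], aeval (MvPolynomial.C t : MvPolynomial ℕ L) b =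
      MvPolynomial.C (aeval t b) := fun b => by
    rw [← MvPolynomial.algebraMap_eq, aeval_algebraMap_apply]
  suffices h : expSeq Fq t (fun k => MvPolynomial.C (aeval t a) * x k) =
      aeval (twistedTheta Fq (MvPolynomial.C t : MvPolynomial ℕ L)) a (expSeq Fq t x) by
    rw [h, aeval_twistedTheta_apply]
    simp only [hC]
  clear n
  induction a using polynomial_induction_X_mul with
  | one => simp
  | add a b ha hb =>
    simp only [map_add, add_mul, LinearMap.add_apply, ← ha, ← hb]
    rw [← map_add]
    rfl
  | smul c a ha =>
    rw [map_smul (aeval (twistedTheta Fq (MvPolynomial.C t : MvPolynomial ℕ L))),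
      LinearMap.smul_apply, ← ha, ← map_smul]
    congr 1
    ext1 k
    rw [Pi.smul_apply, ← hC, ← hC, ← smul_mul_assoc, map_smul]
  | X_mul a ha =>
    rw [map_mul (aeval (twistedTheta Fq (MvPolynomial.C t : MvPolynomial ℕ L))), aeval_X,
      Module.End.mul_apply, ← ha]
    simp only [map_mul, aeval_X, mul_assoc]
    exact expSeq_C_theta_mul ht _

/-- `F ↦ a * F` as an algebra homomorphism. -/
def starHom (t : L) (a : Fq[X]) : MvPolynomial ℕ L →ₐ[L] MvPolynomial ℕ L :=
  MvPolynomial.aeval fun j => carlitz Fq (MvPolynomial.C t) a (MvPolynomial.X j)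

theorem starAction_eq (a : Fq[X]) (F : MvPolynomial ℕ L) :
    starAction Fq t a F = starHom t a F := rfl

@[simp]
theorem starHom_X (a : Fq[X]) (j : ℕ) :
    starHom t a (MvPolynomial.X j) = carlitz Fq (MvPolynomial.C t) a (MvPolynomial.X j) := by
  simp [starHom]

theorem algHom_carlitz (φ : MvPolynomial ℕ L →ₐ[L] MvPolynomial ℕ L) (a : Fq[X])
    (x : MvPolynomial ℕ L) :
    φ (carlitz Fq (MvPolynomial.C t) a x) = carlitz Fq (MvPolynomial.C t) a (φ x) := by
  have h := map_carlitz (φ.restrictScalars Fq) (MvPolynomial.C t) x a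
  simpa [← MvPolynomial.algebraMap_eq] using h

theorem starHom_starHom (a b : Fq[X]) (F : MvPolynomial ℕ L) :
    starHom t b (starHom t a F) = starHom t (b * a) F := by
  rw [← AlgHom.comp_apply]
  congr 1
  refine MvPolynomial.algHom_ext fun j => ?_
  rw [AlgHom.comp_apply, starHom_X, algHom_carlitz, starHom_X, starHom_X, mul_comm, carlitz_mul]

theorem mem_monicOfDegree {k : ℕ} {a : Fq[X]} :
    a ∈ monicOfDegree Fq k ↔ a.Monic ∧ a.natDegree = k := by
  simp [monicOfDegree]

end LogAlgCoeff

/-! ### Integrality of the coefficients of `𝔏(F, Z)` -/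

section Integrality

variable {Fq : Type*} [Field Fq] [Fintype Fq]

local notation "q" => Fintype.card Fq

/-- Modulo `P` the two maps `f ↦ f ^ (q ^ deg P)` and `f ↦ P * f` are ring homomorphisms. They agree
on constants by `hO`, and on variables because `C_P ≡ τ ^ deg P`. -/
theorem C_dvd_pow_sub_aeval_carlitz {O : Type*} [CommRing O] [Algebra Fq O] (θ : O) {P : Fq[X]}
    (hP : Irreducible P) (hPm : P.Monic)
    (hO : ∀ x : O, aeval θ P ∣ x ^ q ^ P.natDegree - x) (f : MvPolynomial ℕ O) :
    MvPolynomial.C (aeval θ P) ∣ f ^ q ^ P.natDegree -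
      MvPolynomial.aeval (fun j => carlitz Fq (MvPolynomial.C θ : MvPolynomial ℕ O) P
        (MvPolynomial.X j)) f := by
  set I : Ideal (MvPolynomial ℕ O) := Ideal.span {MvPolynomial.C (aeval θ P)}
  set ψ : MvPolynomial ℕ O →ₐ[O] MvPolynomial ℕ O := MvPolynomial.aeval fun j =>
    carlitz Fq (MvPolynomial.C θ : MvPolynomial ℕ O) P (MvPolynomial.X j)
  have key : ((Ideal.Quotient.mk I).comp (frobPow Fq (MvPolynomial ℕ O) P.natDegree).toRingHom) =
      (Ideal.Quotient.mk I).comp ψ.toRingHom := by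
    refine MvPolynomial.ringHom_ext (fun x => ?_) (fun j => ?_)
    · rw [RingHom.comp_apply, RingHom.comp_apply, Ideal.Quotient.eq, Ideal.mem_span_singleton]
      simp only [AlgHom.toRingHom_eq_coe, RingHom.coe_coe, frobPow_apply]
      rw [← map_pow, ← MvPolynomial.algebraMap_eq, AlgHom.commutes, MvPolynomial.algebraMap_eq,
        ← map_sub]
      exact map_dvd _ (hO x)
    · rw [RingHom.comp_apply, RingHom.comp_apply, Ideal.Quotient.eq, Ideal.mem_span_singleton]
      simp only [AlgHom.toRingHom_eq_coe, RingHom.coe_coe, frobPow_apply, ψ, MvPolynomial.aeval_X]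
      rw [carlitz_apply, Finset.sum_range_succ, carlitzCoeff_natDegree, hPm.leadingCoeff, map_one,
        map_one, one_mul, sub_add_cancel_right, dvd_neg]
      refine Finset.dvd_sum fun i hi => Dvd.dvd.mul_right ?_ _
      rw [← MvPolynomial.algebraMap_eq, ← aeval_algebraMap_apply]
      exact map_dvd _ (hP.dvd_carlitzCoeff (Finset.mem_range.1 hi))
  have := RingHom.congr_fun key f
  rw [RingHom.comp_apply, RingHom.comp_apply, Ideal.Quotient.eq, Ideal.mem_span_singleton] at this
  simpa using this

variable {L : Type*} [Field L] [Algebra Fq L] {t : L}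

variable (ht : Function.Injective (aeval t : Fq[X] →ₐ[Fq] L))

include ht

open Classical in
-- The terms with `a = P b` contribute `P * ((b * F) / b)`, so they reassemble into `P * L_{k - deg
-- P}(F)`; the others have denominators prime to `P`.
theorem C_mul_Lcoeff {P : Fq[X]} (hP : P ≠ 0) (hPm : P.Monic) (F : MvPolynomial ℕ L) (k : ℕ) :
    MvPolynomial.C (aeval t P) * Lcoeff Fq t F k =
      (if P.natDegree ≤ k then starHom t P (Lcoeff Fq t F (k - P.natDegree)) else 0) +
      MvPolynomial.C (aeval t P) * ∑ a ∈ (monicOfDegree Fq k).filter (fun a => ¬ P ∣ a),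
        MvPolynomial.C (aeval t a)⁻¹ * starAction Fq t a F := by
  have hPt := aeval_ne_zero_of_injective ht hP
  rw [Lcoeff, ← Finset.sum_filter_add_sum_filter_not _ (fun a => P ∣ a), mul_add]
  congr 1
  split_ifs with h
  · rw [Lcoeff, map_sum, Finset.mul_sum]
    symm
    refine Finset.sum_bij (fun b _ => P * b) (fun b hb => ?_) (fun b _ c _ h' => ?_)
      (fun a ha => ?_) (fun b _ => ?_)
    · rw [mem_monicOfDegree] at hb
      rw [Finset.mem_filter, mem_monicOfDegree]
      refine ⟨⟨hPm.mul hb.1, ?_⟩, dvd_mul_right _ _⟩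
      rw [hPm.natDegree_mul hb.1, hb.2]
      omega
    · exact mul_left_cancel₀ hP h'
    · rw [Finset.mem_filter, mem_monicOfDegree] at ha
      obtain ⟨⟨ham, had⟩, b, rfl⟩ := ha
      have hb := hPm.of_mul_monic_left ham
      refine ⟨b, mem_monicOfDegree.2 ⟨hb, ?_⟩, rfl⟩
      rw [hPm.natDegree_mul hb] at had
      omega
    · rw [map_mul, ← MvPolynomial.algebraMap_eq, AlgHom.commutes, MvPolynomial.algebraMap_eq,
        starAction_eq, starAction_eq, starHom_starHom, map_mul, mul_inv, map_mul, ← mul_assoc,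
        ← mul_assoc, ← map_mul, mul_inv_cancel₀ hPt, map_one, one_mul]
  · rw [Finset.sum_eq_zero, mul_zero]
    intro a ha
    rw [Finset.mem_filter, mem_monicOfDegree] at ha
    exact absurd (Polynomial.natDegree_le_of_dvd ha.2 ha.1.1.ne_zero) (by omega)

theorem logAlgCoeff_mem_range_map_local {P : Fq[X]} (hP : Irreducible P) (hPm : P.Monic)
    {F : MvPolynomial ℕ L}
    (hF : F ∈ (MvPolynomial.mapAlgHom (σ := ℕ) (localSubalgebra t hP).val).range) (n : ℕ) :
    logAlgCoeff Fq t F n ∈ (MvPolynomial.mapAlgHom (σ := ℕ) (localSubalgebra t hP).val).range := by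
  classical
  set O := localSubalgebra t hP
  set ι : MvPolynomial ℕ O →ₐ[Fq] MvPolynomial ℕ L := MvPolynomial.mapAlgHom (σ := ℕ) O.val
  set π := aeval t P
  have hπ : π ≠ 0 := aeval_ne_zero_of_injective ht hP.ne_zero
  let θ : O := ⟨t, by simpa using aeval_mem_localSubalgebra (t := t) hP X⟩
  have hι : ∀ x : O, ι (MvPolynomial.C x) = MvPolynomial.C (x : L) := fun x => by
    simp [ι, MvPolynomial.mapAlgHom_apply]
  have hιX : ∀ j, ι (MvPolynomial.X j) = MvPolynomial.X j := fun x => by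
    simp [ι, MvPolynomial.mapAlgHom_apply]
  have hCO : ∀ x ∈ O, MvPolynomial.C x ∈ ι.range := fun x hx => ⟨MvPolynomial.C ⟨x, hx⟩, hι _⟩
  have hθ : ∀ a : Fq[X], ((aeval θ a : O) : L) = aeval t a := fun a =>
    (aeval_algHom_apply O.val θ a).symm
  let ψ (a : Fq[X]) : MvPolynomial ℕ O →ₐ[O] MvPolynomial ℕ O := MvPolynomial.aeval fun j =>
    carlitz Fq (MvPolynomial.C θ : MvPolynomial ℕ O) a (MvPolynomial.X j)
  have hψ : ∀ a f, starHom t a (ι f) = ι (ψ a f) := fun a f => by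
    have : (starHom t a).toRingHom.comp ι.toRingHom = ι.toRingHom.comp (ψ a).toRingHom := by
      refine MvPolynomial.ringHom_ext (fun x => ?_) (fun j => ?_)
      · simp only [RingHom.comp_apply, AlgHom.toRingHom_eq_coe, RingHom.coe_coe, hι, ψ]
        rw [MvPolynomial.algHom_C, MvPolynomial.algHom_C]
        exact (hι x).symm
      · simp only [RingHom.comp_apply, AlgHom.toRingHom_eq_coe, RingHom.coe_coe, hιX, ψ, starHom_X,
          MvPolynomial.aeval_X, map_carlitz, hι]
        rfl
    exact RingHom.congr_fun this f
  -- `M` is the set of multiples of `P` among the polynomials with `P`-integral coefficients; the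
  -- goal becomes `π u_n ∈ M`.
  let M : AddSubgroup (MvPolynomial ℕ L) :=
    ι.range.toSubmodule.toAddSubgroup.map (AddMonoidHom.mulLeft (MvPolynomial.C π))
  have hM : ∀ x ∈ ι.range, MvPolynomial.C π * x ∈ M := fun x hx => ⟨x, hx, rfl⟩
  have hM' : ∀ f : MvPolynomial ℕ O, MvPolynomial.C (aeval θ P) ∣ f → ι f ∈ M := by
    rintro _ ⟨f, rfl⟩
    rw [map_mul, hι, hθ]
    exact hM _ ⟨f, rfl⟩
  let L' : ℕ → MvPolynomial ℕ L := fun k =>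
    ∑ a ∈ (monicOfDegree Fq k).filter (fun a => ¬ P ∣ a),
        MvPolynomial.C (aeval t a)⁻¹ * starAction Fq t a F
  have hL' : ∀ k, L' k ∈ ι.range := fun k => by
    refine sum_mem fun a ha => mul_mem (hCO _ (inv_aeval_mem_localSubalgebra ht hP ?_)) ?_
    · exact (Finset.mem_filter.1 ha).2
    · obtain ⟨f, rfl⟩ := hF
      exact ⟨ψ a f, (hψ a f).symm⟩
  have hE : ∀ n, expSeq Fq t (fun k => MvPolynomial.C π * L' k) n ∈ M := fun n => by
    rw [expSeq_apply]
    refine sum_mem fun i _ => ?_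
    obtain ⟨y, hy, h⟩ := pow_mul_inv_carlitzD_local ht hP i
    rw [mul_pow, ← mul_assoc, ← map_pow, ← map_mul, mul_comm _ (π ^ _), h, map_mul, mul_assoc]
    exact hM _ (mul_mem (hCO _ hy) (pow_mem (hL' _) _))
  -- This is `exp_C` applied to the decomposition of `π L_k`: the left side is `C_P` acting on the
  -- twisted series of the coefficients, and `P *` commutes with `exp_C`.
  have hEq : ∀ n, (∑ j ∈ Finset.range (n + 1), MvPolynomial.C (aeval t (carlitzCoeff P j)) *
        logAlgCoeff Fq t F (n - j) ^ q ^ j) =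
      (if P.natDegree ≤ n then starHom t P (logAlgCoeff Fq t F (n - P.natDegree)) else 0) +
        expSeq Fq t (fun k => MvPolynomial.C π * L' k) n := fun n => by
    simp only [logAlgCoeff]
    rw [← expSeq_C_mul ht, map_expSeq, ← expSeq_shift (fun k => starHom t P (Lcoeff Fq t F k)),
      ← Pi.add_apply, ← map_add]
    exact congrFun (congrArg _ (funext fun k => C_mul_Lcoeff ht hP.ne_zero hPm F k)) n
  induction n using Nat.strong_induction_on with
  | _ n ih =>
    set u := logAlgCoeff Fq t F
    have hterm : ∀ j < n, j + 1 ≠ P.natDegree →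
        MvPolynomial.C (aeval t (carlitzCoeff P (j + 1))) * u (n - (j + 1)) ^ q ^ (j + 1) ∈ M := by
      intro j hj hjd
      rcases lt_or_gt_of_ne hjd with h | h
      · obtain ⟨c, hc⟩ := hP.dvd_carlitzCoeff h
        rw [hc, map_mul, map_mul, mul_assoc]
        exact hM _ (mul_mem (hCO _ (aeval_mem_localSubalgebra hP c))
          (pow_mem (ih _ (by omega)) _))
      · rw [carlitzCoeff_of_natDegree_lt h, map_zero, map_zero, zero_mul]
        exact zero_mem _
    have hd : 0 < P.natDegree := hP.natDegree_pos
    -- The term `j + 1 = deg P` is `u_{n - deg P} ^ (q ^ deg P)`, congruent to `P * u_{n - deg P}`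
    -- modulo `P`; all other terms with positive index already lie in `M`.
    have hdiff : (if P.natDegree ≤ n then starHom t P (u (n - P.natDegree)) else 0) -
        ∑ j ∈ Finset.range n, MvPolynomial.C (aeval t (carlitzCoeff P (j + 1))) *
          u (n - (j + 1)) ^ q ^ (j + 1) ∈ M := by
      split_ifs with h
      · rw [← Finset.add_sum_erase (Finset.range n) _
          (Finset.mem_range.2 (show P.natDegree - 1 < n by omega)), ← sub_sub]
        refine sub_mem ?_ (sum_mem fun j hj => ?_)
        · obtain ⟨f, hf⟩ := ih (n - P.natDegree) (by omega)
          rw [Nat.sub_add_cancel hd, carlitzCoeff_natDegree, hPm.leadingCoeff, map_one, map_one,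
            map_one, one_mul, ← hf]
          change starHom t P (ι f) - ι f ^ _ ∈ M
          rw [hψ, ← map_pow, ← map_sub, ← neg_sub, map_neg]
          exact neg_mem (hM' _ (C_dvd_pow_sub_aeval_carlitz θ hP hPm (fun x => by
            rw [show aeval θ P = ⟨aeval t P, aeval_mem_localSubalgebra hP P⟩ from
              Subtype.ext (hθ P)]
            exact dvd_pow_card_pow_sub_localSubalgebra ht hP x) f))
        · rw [Finset.mem_erase, Finset.mem_range] at hj
          exact hterm j hj.2 (by omega)
      · rw [zero_sub]
        exact neg_mem (sum_mem fun j hj => by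
          rw [Finset.mem_range] at hj
          exact hterm j hj (by omega))
    have hun : MvPolynomial.C π * u n ∈ M := by
      have h := hEq n
      rw [Finset.sum_range_succ', carlitzCoeff_zero, pow_zero, pow_one, Nat.sub_zero] at h
      convert add_mem hdiff (hE n) using 1
      linear_combination h
    obtain ⟨x, hx, h⟩ := hun
    have hxu : x = u n := mul_left_cancel₀ (MvPolynomial.C_ne_zero.2 hπ) h
    exact hxu ▸ hx

theorem logAlgCoeff_mem_range_map {F : MvPolynomial ℕ L}
    (hF : F ∈ (MvPolynomial.mapAlgHom (σ := ℕ) (aeval t : Fq[X] →ₐ[Fq] L)).range) (n : ℕ) :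
    logAlgCoeff Fq t F n ∈ (MvPolynomial.mapAlgHom (σ := ℕ) (aeval t : Fq[X] →ₐ[Fq] L)).range := by
  rw [← Subalgebra.mem_toSubmodule, MvPolynomial.range_mapAlgHom, MvPolynomial.mem_coeffsIn]
  intro m
  refine mem_range_aeval_of_forall_local fun P hP hPm => ?_
  obtain ⟨f, hf⟩ := logAlgCoeff_mem_range_map_local ht hP hPm (F := F) (by
    obtain ⟨F, rfl⟩ := hF
    let θ : localSubalgebra t hP := ⟨t, by simpa using aeval_mem_localSubalgebra (t := t) hP X⟩
    refine ⟨MvPolynomial.mapAlgHom (aeval θ) F, ?_⟩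
    simp only [AlgHom.toRingHom_eq_coe, RingHom.coe_coe, MvPolynomial.mapAlgHom_apply]
    rw [MvPolynomial.map_map]
    congr 2
    refine RingHom.ext fun a => ?_
    exact (aeval_algHom_apply (localSubalgebra t hP).val θ a).symm) n
  rw [← hf]
  simp only [AlgHom.toRingHom_eq_coe, RingHom.coe_coe, MvPolynomial.mapAlgHom_apply,
    MvPolynomial.coeff_map]
  exact (f.coeff m).2

end Integrality

/-! ### Vanishing of the coefficients of large degree -/

section Vanishing

variable {Fq : Type*} [Field Fq] [Fintype Fq]

local notation "q" => Fintype.card Fq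

/-- The `𝔽_q`-linear map `∑ c_l T ^ l ↦ ∑ c_l C_{θ ^ l}(x)` from `A[T]`. -/
def carlitzSubst {R : Type*} [CommRing R] [Algebra Fq R] (t x : R) : Fq[X][X] →ₗ[Fq] R :=
  Polynomial.lsum fun l => (LinearMap.mulRight Fq (carlitz Fq t (X ^ l) x)) ∘ₗ
    (aeval t : Fq[X] →ₐ[Fq] R).toLinearMap

section

variable {R : Type*} [CommRing R] [Algebra Fq R] (t x : R)

theorem carlitzSubst_apply (G : Fq[X][X]) :
    carlitzSubst t x G = G.sum fun l c => aeval t c * carlitz Fq t (X ^ l) x := rfl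

theorem carlitzSubst_monomial (l : ℕ) (c : Fq[X]) :
    carlitzSubst t x (monomial l c) = aeval t c * carlitz Fq t (X ^ l) x := by
  rw [carlitzSubst_apply, sum_monomial_index _ _ (by simp)]

/-- The variable `T` stands for the operator `C_θ` applied to `x`, while the coefficients in `A` act
by ordinary multiplication. -/
theorem carlitzSubst_mul_X (G : Fq[X][X]) :
    carlitzSubst t x (G * X) = carlitzSubst t (carlitzTheta Fq t x) G := by
  induction G using Polynomial.induction_on' with
  | add G H hG hH => rw [add_mul, map_add, hG, hH, map_add]
  | monomial l c =>
    rw [monomial_mul_X, carlitzSubst_monomial, carlitzSubst_monomial, pow_succ, carlitz_mul]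
    simp [carlitz]

theorem carlitzSubst_mul_C (G : Fq[X][X]) (c : Fq[X]) :
    carlitzSubst t x (G * C c) = aeval t c * carlitzSubst t x G := by
  induction G using Polynomial.induction_on' with
  | add G H hG hH => rw [add_mul, map_add, hG, hH, map_add, mul_add]
  | monomial l d =>
    rw [monomial_mul_C, carlitzSubst_monomial, carlitzSubst_monomial, map_mul]
    ring

theorem carlitzSubst_map_C (a : Fq[X]) :
    carlitzSubst t x (a.map C) = carlitz Fq t a x := by
  induction a using polynomial_induction_X_mul generalizing x with
  | one =>
    rw [Polynomial.map_one, ← monomial_zero_one, carlitzSubst_monomial]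
    simp
  | add a b ha hb => rw [Polynomial.map_add, map_add, ha, hb, map_add, LinearMap.add_apply]
  | smul c a ha =>
    rw [map_smul, LinearMap.smul_apply, ← ha, ← map_smul]
    congr 1
    ext1 l
    rw [coeff_map, coeff_smul, coeff_smul, coeff_map, smul_eq_mul, map_mul, smul_eq_C_mul]
  | X_mul a ha =>
    rw [mul_comm, Polynomial.map_mul, map_X, carlitzSubst_mul_X, ha, carlitz_mul]
    simp [carlitz]

variable (Fq) in
/-- The polynomial `∏_{r < i} (T - θ ^ (q ^ r))`. -/
def carlitzB (i : ℕ) : Fq[X][X] := ∏ r ∈ Finset.range i, (X - C (X ^ q ^ r))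

/-- Since `y ^ q = C_θ(y) - θ y`, each further `q`-th power multiplies by a factor `T - θ ^ (q ^
i)`. -/
theorem carlitz_pow_card_pow (a : Fq[X]) (i : ℕ) :
    carlitz Fq t a x ^ q ^ i = carlitzSubst t x (a.map C * carlitzB Fq i) := by
  induction i generalizing x with
  | zero => simp [carlitzB, carlitzSubst_map_C]
  | succ i ih =>
    rw [carlitzB, Finset.prod_range_succ, ← carlitzB, ← mul_assoc, mul_sub, map_sub,
      carlitzSubst_mul_X, carlitzSubst_mul_C, ← ih, ← ih, map_pow, aeval_X, ← mul_pow,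
      ← sub_pow_card_pow, pow_succ', pow_mul]
    congr 1
    have : carlitz Fq t a (carlitzTheta Fq t x) =
        t * carlitz Fq t a x + carlitz Fq t a x ^ q := by
      rw [← carlitz_X_mul, mul_comm, carlitz_mul]
      simp [carlitz]
    rw [this]
    ring

theorem natDegree_mul_carlitzB_lt (a : Fq[X]) (i : ℕ) :
    (a.map C * carlitzB Fq i).natDegree < a.natDegree + i + 1 := by
  refine Nat.lt_succ_of_le (natDegree_mul_le.trans (add_le_add (natDegree_map_le ..) ?_))
  refine (natDegree_prod_le _ _).trans ?_
  simp only [natDegree_X_sub_C, Finset.sum_const, Finset.card_range, smul_eq_mul, mul_one, le_refl]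

theorem natDegree_coeff_mul_carlitzB_le (a : Fq[X]) (i l : ℕ) :
    ((a.map C * carlitzB Fq i).coeff l).natDegree ≤ q ^ i := by
  have hq : 1 < q := Fintype.one_lt_card
  suffices h : ∀ l, ((a.map C * carlitzB Fq i).coeff l).natDegree ≤ q ^ i - 1 from
    (h l).trans (Nat.sub_le _ _)
  induction i with
  | zero => intro l; simp [carlitzB]
  | succ i ih =>
    have h1 : q ^ i - 1 + q ^ i ≤ q ^ (i + 1) - 1 := by
      have : q ^ i * 2 ≤ q ^ i * q := Nat.mul_le_mul_left _ hq
      have : 1 ≤ q ^ i := Nat.one_le_pow _ _ (by omega)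
      rw [pow_succ]
      omega
    have h2 : ∀ l, ((a.map C * carlitzB Fq i).coeff l * X ^ q ^ i).natDegree ≤
        q ^ (i + 1) - 1 := fun l =>
      natDegree_mul_le.trans ((add_le_add (ih l) (natDegree_X_pow_le _)).trans h1)
    intro l
    rw [carlitzB, Finset.prod_range_succ, ← carlitzB, ← mul_assoc]
    cases l with
    | zero =>
      rw [mul_coeff_zero, coeff_sub, coeff_X_zero, coeff_C_zero, zero_sub, mul_neg, natDegree_neg]
      exact h2 0
    | succ l =>
      rw [coeff_mul_X_sub_C]
      exact (natDegree_sub_le _ _).trans (max_le ((ih l).trans (by omega)) (h2 _))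

end

variable {L : Type*} [Field L] [Algebra Fq L] (t : L)

/-- The elements `a / b` with `deg a < deg b`. -/
def negDegree (ht : Function.Injective (aeval t : Fq[X] →ₐ[Fq] L)) : AddSubmonoid L where
  carrier := {x | ∃ a b : Fq[X], b ≠ 0 ∧ a.degree < b.degree ∧ x = aeval t a / aeval t b}
  zero_mem' := ⟨0, 1, one_ne_zero, by simp, by simp⟩
  add_mem' := by
    rintro x y ⟨a, b, hb, hab, rfl⟩ ⟨c, d, hd, hcd, rfl⟩
    have hbt := aeval_ne_zero_of_injective ht hb
    have hdt := aeval_ne_zero_of_injective ht hd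
    refine ⟨a * d + b * c, b * d, mul_ne_zero hb hd, ?_, ?_⟩
    · refine (degree_add_le _ _).trans_lt (max_lt ?_ ?_)
      · rw [degree_mul, degree_mul]
        exact WithBot.add_lt_add_right (degree_ne_bot.2 hd) hab
      · rw [degree_mul, degree_mul]
        exact WithBot.add_lt_add_left (degree_ne_bot.2 hb) hcd
    · rw [map_add, map_mul, map_mul, map_mul, div_add_div _ _ hbt hdt]

variable {t} (ht : Function.Injective (aeval t : Fq[X] →ₐ[Fq] L))

include ht

omit [Fintype Fq] in
theorem eq_zero_of_mem_negDegree {x : L} (hx : x ∈ negDegree t ht)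
    (hx' : x ∈ (aeval t : Fq[X] →ₐ[Fq] L).range) : x = 0 := by
  obtain ⟨a, b, hb, hab, h⟩ := hx
  obtain ⟨c, rfl⟩ := hx'
  rw [eq_div_iff (aeval_ne_zero_of_injective ht hb)] at h
  change aeval t c * aeval t b = aeval t a at h
  rw [← map_mul] at h
  by_contra hc
  have hc0 : c ≠ 0 := by rintro rfl; exact hc (map_zero _)
  rw [← ht h, degree_mul] at hab
  have h1 : (0 : WithBot ℕ) ≤ c.degree := zero_le_degree_iff.2 hc0
  exact absurd hab (not_lt.2 (le_add_of_nonneg_left h1))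

omit ht in
variable (Fq t) in
theorem exists_monic_aeval_eq_carlitzD (i : ℕ) :
    ∃ d : Fq[X], d.Monic ∧ d.natDegree = i * q ^ i ∧ aeval t d = carlitzD Fq t i := by
  induction i with
  | zero => exact ⟨1, monic_one, by simp, by simp [carlitzD]⟩
  | succ i ih =>
    obtain ⟨d, hd, hdeg, h⟩ := ih
    have hq : 1 < q := Fintype.one_lt_card
    have h1 : 1 < q ^ (i + 1) := Nat.one_lt_pow (Nat.succ_ne_zero i) hq
    have hm : (X ^ q ^ (i + 1) - X : Fq[X]).Monic := monic_X_pow_sub (by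
      rw [degree_X]; exact_mod_cast h1)
    refine ⟨(X ^ q ^ (i + 1) - X) * d ^ q, hm.mul (hd.pow _), ?_, ?_⟩
    · rw [hm.natDegree_mul (hd.pow _), hd.natDegree_pow, hdeg,
        FiniteField.X_pow_card_sub_X_natDegree_eq Fq h1]
      ring
    · simp [carlitzD, h]

section

variable {s : ℕ}

omit ht in
variable (Fq) in
/-- The exponent of `X_1 ^ (q ^ φ_1) ⋯ X_s ^ (q ^ φ_s)`. -/
def qExponent (φ : Fin s → ℕ) : ℕ →₀ ℕ := ∑ j : Fin s, Finsupp.single (j : ℕ) (q ^ φ j)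

omit ht in
theorem qExponent_apply (φ : Fin s → ℕ) (j : Fin s) : qExponent Fq φ j = q ^ φ j := by
  simp [qExponent, Finsupp.finsetSum_apply, Finsupp.single_apply, Fin.val_inj]

omit ht in
theorem qExponent_injective : Function.Injective (qExponent Fq : (Fin s → ℕ) → ℕ →₀ ℕ) := by
  intro φ ψ h
  ext j
  have := congrArg (fun m : ℕ →₀ ℕ => m j) h
  simp only [qExponent_apply] at this
  exact Nat.pow_right_injective (Fintype.one_lt_card (α := Fq)) this

omit ht in
theorem coeff_prod_carlitz_X (φ : Fin s → ℕ) (a : Fin s → Fq[X]) :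
    (∏ j : Fin s, carlitz Fq (MvPolynomial.C t) (a j)
      (MvPolynomial.X (j : ℕ) : MvPolynomial ℕ L)).coeff (qExponent Fq φ) =
      ∏ j, aeval t (carlitzCoeff (a j) (φ j)) := by
  obtain ⟨N, hN⟩ : ∃ N, ∀ j, φ j < N ∧ (a j).natDegree < N := by
    refine ⟨∑ j, (φ j + (a j).natDegree) + 1, fun j => ?_⟩
    have := Finset.single_le_sum (f := fun j => φ j + (a j).natDegree) (fun _ _ => Nat.zero_le _)
      (Finset.mem_univ j)
    omega
  have h1 : ∀ j : Fin s, carlitz Fq (MvPolynomial.C t) (a j)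
      (MvPolynomial.X (j : ℕ) : MvPolynomial ℕ L) = ∑ e ∈ Finset.range N,
        MvPolynomial.monomial (Finsupp.single (j : ℕ) (q ^ e))
          (aeval t (carlitzCoeff (a j) e)) := fun j => by
    rw [carlitz_apply_of_lt _ _ (hN j).2]
    refine Finset.sum_congr rfl fun e _ => ?_
    rw [← MvPolynomial.algebraMap_eq, aeval_algebraMap_apply, MvPolynomial.algebraMap_eq,
      MvPolynomial.C_mul_X_pow_eq_monomial]
  simp only [h1]
  rw [Finset.prod_univ_sum, MvPolynomial.coeff_sum]
  have h2 : ∀ ψ : Fin s → ℕ, (∏ j : Fin s,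
      MvPolynomial.monomial (Finsupp.single (j : ℕ) (q ^ ψ j))
        (aeval t (carlitzCoeff (a j) (ψ j)))) = MvPolynomial.monomial (qExponent Fq ψ)
          (∏ j, aeval t (carlitzCoeff (a j) (ψ j))) := fun ψ =>
    (MvPolynomial.monomial_sum_prod _ _ _).symm
  rw [Finset.sum_eq_single φ]
  · rw [h2, MvPolynomial.coeff_monomial, if_pos rfl]
  · intro ψ _ hψ
    rw [h2, MvPolynomial.coeff_monomial, if_neg (qExponent_injective.ne hψ)]
  · intro h
    exact absurd (Fintype.mem_piFinset.2 fun j => Finset.mem_range.2 (hN j).1) h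

omit ht in
-- The products of the `C_{θ ^ φ_j}(X_j)` are unitriangular with respect to the monomials `∏ X_j ^
-- (q ^ φ_j)`, so integrality of a combination passes to its coefficients.
theorem mem_range_aeval_of_sum_carlitz (S : Finset (Fin s → ℕ)) (g : (Fin s → ℕ) → L)
    (h : ∑ φ ∈ S, MvPolynomial.C (g φ) * ∏ j : Fin s, carlitz Fq (MvPolynomial.C t) (X ^ φ j)
      (MvPolynomial.X (j : ℕ) : MvPolynomial ℕ L) ∈
        (MvPolynomial.mapAlgHom (σ := ℕ) (aeval t : Fq[X] →ₐ[Fq] L)).range) :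
    ∀ φ ∈ S, g φ ∈ (aeval t : Fq[X] →ₐ[Fq] L).range := by
  classical
  induction S using Finset.strongInduction with
  | H S ih =>
    rcases S.eq_empty_or_nonempty with rfl | hS
    · simp
    -- The monomial of `φ` occurs in the product of `ψ` only if `φ ≤ ψ` componentwise; maximality of
    -- the sum leaves `ψ = φ`.
    obtain ⟨φ, hφ, hmax⟩ := S.exists_max_image (fun φ => ∑ j, φ j) hS
    have hgφ : g φ ∈ (aeval t : Fq[X] →ₐ[Fq] L).range := by
      have hc := h
      rw [← Subalgebra.mem_toSubmodule, MvPolynomial.range_mapAlgHom,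
        MvPolynomial.mem_coeffsIn] at hc
      have hc := hc (qExponent Fq φ)
      rw [MvPolynomial.coeff_sum, Finset.sum_eq_single φ] at hc
      · rw [MvPolynomial.coeff_C_mul, coeff_prod_carlitz_X] at hc
        simpa only [carlitzCoeff_X_pow_self, map_one, Finset.prod_const_one, mul_one,
          Subalgebra.mem_toSubmodule] using hc
      · intro ψ hψ hne
        rw [MvPolynomial.coeff_C_mul, coeff_prod_carlitz_X]
        obtain ⟨j, hj⟩ : ∃ j, ψ j < φ j := by
          by_contra! hle
          refine hne (funext fun j => ?_)
          exact ((Finset.sum_eq_sum_iff_of_le fun j _ => hle j).1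
            (le_antisymm (Finset.sum_le_sum fun j _ => hle j) (hmax ψ hψ)) j
              (Finset.mem_univ j)).symm
        rw [Finset.prod_eq_zero (Finset.mem_univ j), mul_zero]
        rw [carlitzCoeff_X_pow_of_lt hj, map_zero]
      · exact fun hn => absurd hφ hn
    intro ψ hψ
    rcases eq_or_ne ψ φ with rfl | hne
    · exact hgφ
    refine ih (S.erase φ) (Finset.erase_ssubset hφ) ?_ ψ (Finset.mem_erase.2 ⟨hne, hψ⟩)
    rw [Finset.sum_erase_eq_sub hφ]
    refine sub_mem h (mul_mem ?_ (prod_mem fun j _ => ?_))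
    · obtain ⟨c, hc⟩ := hgφ
      refine ⟨MvPolynomial.C c, ?_⟩
      rw [← hc]
      simp
    · refine ⟨carlitz Fq (MvPolynomial.C X) (X ^ φ j) (MvPolynomial.X (j : ℕ)), ?_⟩
      simp only [AlgHom.toRingHom_eq_coe, RingHom.coe_coe]
      rw [map_carlitz]
      simp

end

theorem logAlgCoeff_prod_X_eq_zero {s n : ℕ} (hn : s < n) :
    logAlgCoeff Fq t (∏ j ∈ Finset.range s, MvPolynomial.X j) n = 0 := by
  classical
  let G (a : Fq[X]) (i l : ℕ) : Fq[X] := (a.map C * carlitzB Fq i).coeff l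
  let g (φ : Fin s → ℕ) : L := ∑ i ∈ Finset.range (n + 1), ∑ a ∈ monicOfDegree Fq (n - i),
    (carlitzD Fq t i)⁻¹ * (aeval t a)⁻¹ ^ q ^ i * ∏ j, aeval t (G a i (φ j))
  have hsum : logAlgCoeff Fq t (∏ j ∈ Finset.range s, MvPolynomial.X j) n =
      ∑ φ ∈ Fintype.piFinset (fun _ : Fin s => Finset.range (n + 1)),
        MvPolynomial.C (g φ) * ∏ j : Fin s, carlitz Fq (MvPolynomial.C t) (X ^ φ j)
          (MvPolynomial.X (j : ℕ) : MvPolynomial ℕ L) := by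
    simp only [g, map_sum, Finset.sum_mul]
    rw [Finset.sum_comm, logAlgCoeff, expSeq_apply]
    refine Finset.sum_congr rfl fun i hi => ?_
    rw [Finset.sum_comm, Lcoeff, sum_pow_card_pow, Finset.mul_sum]
    refine Finset.sum_congr rfl fun a ha => ?_
    rw [mul_pow, starAction_eq, map_prod, ← Finset.prod_pow, Finset.prod_range]
    have hG : ∀ j : Fin s, starHom t a (MvPolynomial.X (j : ℕ)) ^ q ^ i =
        ∑ l ∈ Finset.range (n + 1), MvPolynomial.C (aeval t (G a i l)) *
          carlitz Fq (MvPolynomial.C t) (X ^ l) (MvPolynomial.X (j : ℕ) : MvPolynomial ℕ L) := by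
      intro j
      rw [starHom_X, carlitz_pow_card_pow, carlitzSubst_apply, sum_over_range' _ (by simp) (n + 1)]
      · refine Finset.sum_congr rfl fun l _ => ?_
        rw [← MvPolynomial.algebraMap_eq, aeval_algebraMap_apply]
      · refine (natDegree_mul_carlitzB_lt a i).trans_le ?_
        rw [Finset.mem_range] at hi
        rw [(mem_monicOfDegree.1 ha).2]
        omega
    simp only [hG]
    rw [Finset.prod_univ_sum, Finset.mul_sum, Finset.mul_sum]
    refine Finset.sum_congr rfl fun φ _ => ?_
    rw [Finset.prod_mul_distrib]
    simp only [map_mul, map_pow, map_prod]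
    ring
  -- The denominator `D_i a ^ (q ^ i)` has degree `i q ^ i + (n - i) q ^ i = n q ^ i`, whereas the
  -- numerator, a product of `s` coefficients, has degree at most `s q ^ i`.
  have hg : ∀ φ, g φ ∈ negDegree t ht := fun φ => by
    refine AddSubmonoid.sum_mem _ fun i hi => AddSubmonoid.sum_mem _ fun a ha => ?_
    obtain ⟨d, hd, hdeg, h⟩ := exists_monic_aeval_eq_carlitzD Fq t i
    obtain ⟨ham, had⟩ := mem_monicOfDegree.1 ha
    have hm : (d * a ^ q ^ i).Monic := hd.mul (ham.pow _)
    refine ⟨∏ j, G a i (φ j), d * a ^ q ^ i, hm.ne_zero, ?_, ?_⟩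
    · refine degree_lt_degree ?_
      have h1 : (∏ j, G a i (φ j)).natDegree ≤ s * q ^ i := by
        refine (natDegree_prod_le _ _).trans
          ((Finset.sum_le_sum fun j _ => natDegree_coeff_mul_carlitzB_le a i (φ j)).trans ?_)
        simp
      rw [Finset.mem_range] at hi
      rw [hd.natDegree_mul (ham.pow _), ham.natDegree_pow, hdeg, had, mul_comm (q ^ i), ← add_mul,
        Nat.add_sub_cancel' (by omega)]
      exact h1.trans_lt (Nat.mul_lt_mul_of_pos_right hn (pow_pos (card_field_pos Fq) i))
    · rw [map_prod, map_mul, map_pow, h, div_eq_mul_inv, mul_inv, inv_pow]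
      ring
  have hmem := logAlgCoeff_mem_range_map ht
    (F := ∏ j ∈ Finset.range s, MvPolynomial.X j) (prod_mem fun j _ => ⟨MvPolynomial.X j, by simp⟩) n
  rw [hsum] at hmem ⊢
  refine Finset.sum_eq_zero fun φ hφ => ?_
  rw [eq_zero_of_mem_negDegree ht (hg φ) (mem_range_aeval_of_sum_carlitz _ g hmem φ hφ), map_zero,
    zero_mul]

end Vanishing

/-! ### `𝔏(F, Z)` as a power series -/

section PowerSeriesCoeff

variable {Fq : Type*} [Field Fq] [Fintype Fq]

local notation "q" => Fintype.card Fq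

/-- In characteristic `p` a `p`-power of a series is obtained by raising its coefficients and its
variable to that power. -/
theorem coeff_pow_card_pow {R : Type*} [CommRing R] [Algebra Fq R] (f : PowerSeries R) (i n : ℕ) :
    PowerSeries.coeff n (f ^ q ^ i) =
      if q ^ i ∣ n then PowerSeries.coeff (n / q ^ i) f ^ q ^ i else 0 := by
  nontriviality R
  obtain ⟨p, _, e, hp, hcard⟩ := FiniteField.card' Fq
  have : CharP R p := charP_of_injective_algebraMap' Fq p
  have : ExpChar R p := .prime hp
  have key : f ^ p ^ (e * i : ℕ) = PowerSeries.map (iterateFrobenius R p (e * i))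
      (PowerSeries.expand (p ^ (e * i : ℕ)) (pow_ne_zero _ hp.ne_zero) f) :=
    (MvPowerSeries.map_iterateFrobenius_expand p hp.ne_zero f _).symm
  rw [hcard, ← pow_mul, key, PowerSeries.coeff_map, PowerSeries.coeff_expand]
  split_ifs
  · rw [iterateFrobenius_def]
  · rw [map_zero]

variable {L : Type*} [Field L] [Algebra Fq L] (t : L)

theorem coeff_lSeries_pow (F : MvPolynomial ℕ L) (k : ℕ) :
    PowerSeries.coeff (q ^ k) (lSeries Fq t F) = Lcoeff Fq t F k := by
  have hq : 1 < q := Fintype.one_lt_card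
  rw [lSeries, PowerSeries.coeff_mk, Finset.sum_eq_single k]
  · simp
  · intro j _ hj
    rw [if_neg fun h => hj (Nat.pow_right_injective hq h)]
  · intro h
    rw [Finset.mem_range, Nat.lt_succ_iff] at h
    exact absurd (Nat.lt_pow_self hq).le h

theorem coeff_lSeries_of_ne (F : MvPolynomial ℕ L) {n : ℕ} (hn : ∀ k, q ^ k ≠ n) :
    PowerSeries.coeff n (lSeries Fq t F) = 0 := by
  rw [lSeries, PowerSeries.coeff_mk]
  exact Finset.sum_eq_zero fun k _ => if_neg (hn k)

theorem coeff_logAlgSeries_pow (F : MvPolynomial ℕ L) (k : ℕ) :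
    PowerSeries.coeff (q ^ k) (logAlgSeries Fq t F) = logAlgCoeff Fq t F k := by
  have hq : 1 < q := Fintype.one_lt_card
  rw [logAlgSeries, expC, PowerSeries.coeff_mk, logAlgCoeff, expSeq_apply]
  symm
  refine Finset.sum_subset_zero_on_sdiff
    (Finset.range_mono (Nat.succ_le_succ (Nat.lt_pow_self hq).le)) ?_ ?_
  · intro i hi
    rw [Finset.mem_sdiff, Finset.mem_range, Finset.mem_range] at hi
    rw [coeff_pow_card_pow, if_neg, mul_zero]
    rw [Nat.pow_dvd_pow_iff_le_right hq]
    omega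
  · intro i hi
    rw [Finset.mem_range, Nat.lt_succ_iff] at hi
    rw [coeff_pow_card_pow, if_pos (pow_dvd_pow _ hi), Nat.pow_div hi (by omega),
      coeff_lSeries_pow]

theorem coeff_logAlgSeries_of_ne (F : MvPolynomial ℕ L) {n : ℕ} (hn : ∀ k, q ^ k ≠ n) :
    PowerSeries.coeff n (logAlgSeries Fq t F) = 0 := by
  rw [logAlgSeries, expC, PowerSeries.coeff_mk]
  refine Finset.sum_eq_zero fun i _ => ?_
  rw [coeff_pow_card_pow]
  split_ifs with h
  · obtain ⟨m, rfl⟩ := h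
    have hpos : 0 < q ^ i := pow_pos (card_field_pos Fq) i
    rw [Nat.mul_div_cancel_left _ hpos, coeff_lSeries_of_ne, zero_pow hpos.ne', mul_zero]
    exact fun k hk => hn (i + k) (by rw [pow_add, hk])
  · rw [mul_zero]

variable {t} (ht : Function.Injective (aeval t : Fq[X] →ₐ[Fq] L))

include ht

theorem specialPoly_eq_sum {s N : ℕ} (hN : s < N) :
    specialPoly Fq t s = ∑ n ∈ Finset.range N,
      logAlgCoeff Fq t (∏ j ∈ Finset.range s, MvPolynomial.X j) n := by
  have hq : 1 < q := Fintype.one_lt_card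
  rw [specialPoly, finsum_eq_sum_of_support_subset (s := (Finset.range N).image (q ^ ·)),
    Finset.sum_image fun i _ j _ h => Nat.pow_right_injective hq h]
  · exact Finset.sum_congr rfl fun n _ => coeff_logAlgSeries_pow t _ n
  · intro n hn
    rw [Function.mem_support, specialSeries] at hn
    obtain ⟨k, rfl⟩ : ∃ k, q ^ k = n := by
      by_contra! h
      exact hn (coeff_logAlgSeries_of_ne t _ h)
    rw [coeff_logAlgSeries_pow] at hn
    simp only [Finset.coe_image, Finset.coe_range, Set.mem_image, Set.mem_Iio]
    refine ⟨k, ?_, rfl⟩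
    by_contra h
    exact hn (logAlgCoeff_prod_X_eq_zero ht (by omega))

theorem logAlgCoeff_prod_X_mem_range_map (s n : ℕ) :
    logAlgCoeff Fq t (∏ j ∈ Finset.range s, MvPolynomial.X j) n ∈
      (MvPolynomial.mapAlgHom (σ := ℕ) (aeval t : Fq[X] →ₐ[Fq] L)).range :=
  logAlgCoeff_mem_range_map ht (prod_mem fun j _ => ⟨MvPolynomial.X j, by simp⟩) n

theorem specialPoly_mem_range_map (s : ℕ) :
    specialPoly Fq t s ∈ (MvPolynomial.mapAlgHom (σ := ℕ) (aeval t : Fq[X] →ₐ[Fq] L)).range := by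
  rw [specialPoly_eq_sum ht (Nat.lt_succ_self s)]
  exact sum_mem fun n _ => logAlgCoeff_prod_X_mem_range_map ht s n

theorem exists_polynomial_eq_specialSeries (s : ℕ) :
    ∃ P : Polynomial (MvPolynomial ℕ Fq[X]),
      ((P.map (MvPolynomial.map (aeval t : Fq[X] →ₐ[Fq] L).toRingHom) :
        Polynomial (MvPolynomial ℕ L)) : PowerSeries (MvPolynomial ℕ L)) =
        specialSeries Fq t s := by
  have hq : 1 < q := Fintype.one_lt_card
  choose f hf using logAlgCoeff_prod_X_mem_range_map ht s
  refine ⟨∑ k ∈ Finset.range (s + 1), monomial (q ^ k) (f k), ?_⟩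
  ext1 n
  rw [Polynomial.coeff_coe, Polynomial.coeff_map, finsetSum_coeff, map_sum, specialSeries]
  by_cases hn : ∃ k, q ^ k = n
  · obtain ⟨k, rfl⟩ := hn
    rw [coeff_logAlgSeries_pow]
    have h : ∀ j ∈ Finset.range (s + 1), MvPolynomial.map (aeval t : Fq[X] →ₐ[Fq] L).toRingHom
        ((monomial (q ^ j) (f j)).coeff (q ^ k)) = if k = j then
          logAlgCoeff Fq t (∏ j ∈ Finset.range s, MvPolynomial.X j) k else 0 := fun j _ => by
      rw [coeff_monomial]
      by_cases hjk : k = j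
      · subst hjk
        rw [if_pos rfl, if_pos rfl, ← hf]
        rfl
      · rw [if_neg hjk, if_neg fun h => hjk (Nat.pow_right_injective hq h).symm, map_zero]
    rw [Finset.sum_congr rfl h, Finset.sum_ite_eq]
    split_ifs with hk
    · rfl
    · rw [Finset.mem_range] at hk
      exact (logAlgCoeff_prod_X_eq_zero ht (by omega)).symm
  · push Not at hn
    rw [coeff_logAlgSeries_of_ne t _ hn]
    exact Finset.sum_eq_zero fun j _ => by rw [coeff_monomial, if_neg (hn j), map_zero]

end PowerSeriesCoeff

/-! ### Transcendence of `θ` in `ℂ_∞` -/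

section Cinf

variable (Fq : Type*) [Field Fq] [Fintype Fq]

theorem aeval_theta_eq (a : Fq[X]) :
    aeval (Cinf.theta Fq) a = Cinf.ofK Fq (algebraMap Fq[X] (RatFunc Fq) a) := by
  induction a using Polynomial.induction_on' with
  | add a b ha hb => simp only [map_add, ha, hb]
  | monomial n c =>
    rw [aeval_monomial, ← C_mul_X_pow_eq_monomial, map_mul, map_mul, map_pow, map_pow,
      RatFunc.algebraMap_X, RatFunc.algebraMap_C]
    rfl

theorem aeval_theta_injective :
    Function.Injective (aeval (Cinf.theta Fq) : Fq[X] →ₐ[Fq] Cinf Fq) := by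
  intro a b h
  rw [aeval_theta_eq, aeval_theta_eq] at h
  exact RatFunc.algebraMap_injective Fq ((Cinf.ofK Fq).injective h)

end Cinf

/-! ### Sums over polynomials of bounded degree -/

section PowerSums

variable {Fq : Type*} [Field Fq] [Fintype Fq]

local notation "q" => Fintype.card Fq

omit [Field Fq] in
theorem sum_fin_cons {M : Type*} [AddCommMonoid M] {n : ℕ} (F : (Fin (n + 1) → Fq) → M) :
    ∑ c, F c = ∑ e : Fq, ∑ c : Fin n → Fq, F (Fin.cons e c : Fin (n + 1) → Fq) := by
  rw [← (Fin.consEquiv fun _ : Fin (n + 1) => Fq).sum_comp, Fintype.sum_prod_type]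
  rfl

omit [Field Fq] in
theorem sum_fin_snoc {M : Type*} [AddCommMonoid M] {n : ℕ} (F : (Fin (n + 1) → Fq) → M) :
    ∑ c, F c = ∑ e : Fq, ∑ c : Fin n → Fq, F (Fin.snoc c e : Fin (n + 1) → Fq) := by
  rw [← (Fin.snocEquiv fun _ : Fin (n + 1) => Fq).sum_comp, Fintype.sum_prod_type]
  rfl

theorem card_smul_eq_zero {M : Type*} [AddCommGroup M] [Module Fq M] (x : M) : q • x = 0 := by
  rw [← Nat.cast_smul_eq_nsmul Fq, FiniteField.cast_card_eq_zero, zero_smul]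

theorem card_sub_one_smul {M : Type*} [AddCommGroup M] [Module Fq M] (x : M) :
    (q - 1) • x = -x := by
  have h := card_smul_eq_zero (Fq := Fq) x
  rw [← Nat.sub_add_cancel (card_field_pos Fq), add_smul, Nat.succ_eq_add_one, zero_add,
    one_smul] at h
  exact eq_neg_of_add_eq_zero_left h

/-- With fewer than `n` linear factors, every monomial of the expansion misses one of the `n`
coordinates, and summing over that coordinate multiplies by `q = 0`. The induction splits off the
first coordinate; `T` is the set of factors from which it is taken. -/
theorem sum_prod_linear_eq_zero {R ι : Type*} [CommRing R] [Algebra Fq R] {n : ℕ}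
    (y : Fin n → ι → R) (J : Finset ι) (hJ : J.card < n) :
    ∑ c : Fin n → Fq, ∏ j ∈ J, ∑ l, c l • y l j = 0 := by
  classical
  induction n generalizing J with
  | zero => omega
  | succ n ih =>
    simp only [sum_fin_cons, Fin.sum_univ_succ, Fin.cons_zero, Fin.cons_succ, Finset.prod_add]
    simp only [Finset.sum_comm (s := (Finset.univ : Finset (Fin n → Fq))), ← Finset.mul_sum]
    rw [Finset.sum_comm]
    refine Finset.sum_eq_zero fun T hT => ?_
    rw [Finset.mem_powerset] at hT
    rcases T.eq_empty_or_nonempty with rfl | hne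
    · simp only [Finset.prod_empty, Finset.sum_const, Finset.card_univ, card_smul_eq_zero]
    · refine Finset.sum_eq_zero fun e _ => ?_
      rw [ih (fun l => y l.succ), mul_zero]
      rw [Finset.card_sdiff_of_subset hT]
      have := hne.card_pos
      have := Finset.card_le_card hT
      omega

theorem sum_monicOfDegree {M : Type*} [AddCommMonoid M] (n : ℕ) (G : Fq[X] → M) :
    ∑ a ∈ monicOfDegree Fq n, G a =
      ∑ c : Fin n → Fq, G (X ^ n + ∑ l : Fin n, c l • X ^ (l : ℕ)) := by
  have hdeg : ∀ c : Fin n → Fq, (∑ l : Fin n, c l • X ^ (l : ℕ) : Fq[X]).degree < n := fun c => by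
    simp only [smul_eq_C_mul]
    exact degree_sum_fin_lt c
  have hcoeff : ∀ (c : Fin n → Fq) (k : Fin n),
      (∑ l : Fin n, c l • X ^ (l : ℕ) : Fq[X]).coeff k = c k := fun c k => by
    simp [coeff_X_pow, Fin.val_inj]
  refine Finset.sum_bij' (fun a _ l => a.coeff l)
    (fun c _ => X ^ n + ∑ l : Fin n, c l • X ^ (l : ℕ)) (fun _ _ => Finset.mem_univ _)
    (fun c _ => ?_) (fun a ha => ?_) (fun c _ => ?_) (fun a ha => ?_)
  · refine mem_monicOfDegree.2 ⟨monic_X_pow_add (hdeg c), ?_⟩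
    rw [natDegree_add_eq_left_of_degree_lt, natDegree_X_pow]
    rw [degree_X_pow]
    exact hdeg c
  · obtain ⟨ham, rfl⟩ := mem_monicOfDegree.1 ha
    conv_rhs => rw [ham.as_sum]
    rw [Finset.sum_range]
    simp only [smul_eq_C_mul]
  · ext k
    rw [coeff_add, hcoeff, coeff_X_pow, if_neg k.2.ne, zero_add]
  · obtain ⟨ham, rfl⟩ := mem_monicOfDegree.1 ha
    congr 1
    conv_lhs => rw [ham.as_sum]
    rw [Finset.sum_range]
    simp only [smul_eq_C_mul]

/-- Each monic `a` accounts for its `q - 1` scalar multiples, and `q - 1 = -1` in `𝔽_q`. This turns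
sums over monic polynomials into sums over a vector space. -/
theorem sum_range_sum_monicOfDegree {M : Type*} [AddCommGroup M] [Module Fq M] (G : Fq[X] → M)
    (hG : ∀ (ζ : Fq) (a : Fq[X]), ζ ≠ 0 → G (ζ • a) = G a) (n : ℕ) :
    ∑ k ∈ Finset.range n, ∑ a ∈ monicOfDegree Fq k, G a =
      G 0 - ∑ c : Fin n → Fq, G (∑ l : Fin n, c l • X ^ (l : ℕ)) := by
  classical
  induction n with
  | zero => simp
  | succ n ih =>
    rw [Finset.sum_range_succ, ih, sum_fin_snoc]
    simp only [Fin.sum_univ_castSucc, Fin.snoc_castSucc, Fin.snoc_last, Fin.val_castSucc,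
      Fin.val_last]
    rw [← Finset.add_sum_erase _ _ (Finset.mem_univ (0 : Fq))]
    have h : ∀ ζ ∈ Finset.univ.erase (0 : Fq),
        (∑ c : Fin n → Fq, G ((∑ l : Fin n, c l • X ^ (l : ℕ)) + ζ • X ^ n)) =
          ∑ a ∈ monicOfDegree Fq n, G a := fun ζ hζ => by
      have hζ := Finset.ne_of_mem_erase hζ
      rw [sum_monicOfDegree]
      symm
      refine Fintype.sum_equiv (Equiv.piCongrRight fun _ => Equiv.mulLeft₀ ζ hζ) _ _ fun c => ?_
      rw [← hG ζ _ hζ, add_comm, smul_add, Finset.smul_sum]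
      simp [mul_smul]
    rw [Finset.sum_congr rfl h, Finset.sum_const, Finset.card_erase_of_mem (Finset.mem_univ _),
      Finset.card_univ, card_sub_one_smul]
    simp only [zero_smul, add_zero]
    abel

theorem sum_pow_eq_zero_of_not_dvd {m : ℕ} (hm : m = 0 ∨ ¬ q - 1 ∣ m) : ∑ e : Fq, e ^ m = 0 := by
  rcases hm with rfl | hm
  · simp
  · rw [← FiniteField.forall_pow_eq_one_iff] at hm
    push Not at hm
    obtain ⟨ζ, hζ⟩ := hm
    have h : ∑ e : Fq, e ^ m = (ζ : Fq) ^ m * ∑ e : Fq, e ^ m := by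
      rw [Finset.mul_sum]
      refine (Fintype.sum_equiv (Equiv.mulLeft₀ (ζ : Fq) ζ.ne_zero) _ _ fun e => ?_).symm
      simp [mul_pow]
    have h' : ((ζ : Fq) ^ m - 1) * ∑ e : Fq, e ^ m = 0 := by linear_combination -h
    refine (mul_eq_zero.1 h').resolve_left fun h0 => hζ (Units.ext ?_)
    simpa [sub_eq_zero] using h0

theorem sum_monicOfDegree_eval_pow {m : ℕ} (hm : m = 0 ∨ ¬ q - 1 ∣ m) (c : Fq) (n : ℕ) :
    ∑ a ∈ monicOfDegree Fq n, a.eval c ^ m = if n = 0 then 1 else 0 := by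
  rw [sum_monicOfDegree]
  cases n with
  | zero => simp
  | succ n =>
    rw [if_neg (Nat.succ_ne_zero n), sum_fin_cons, Finset.sum_comm]
    refine Finset.sum_eq_zero fun c' _ => ?_
    simp only [Fin.sum_univ_succ, Fin.cons_zero, Fin.cons_succ]
    rw [← sum_pow_eq_zero_of_not_dvd hm]
    -- With the other coefficients fixed, varying the constant term makes the value at `c` run once
    -- through `𝔽_q`.
    refine Fintype.sum_equiv (Equiv.addRight (c ^ (n + 1) + ∑ l : Fin n, c' l * c ^ (l + 1 : ℕ)))
      _ _ fun e => ?_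
    congr 1
    simp [eval_finsetSum]
    ring

end PowerSums

/-! ### The trivial zeros -/

section TrivialZeros

variable {Fq : Type*} [Field Fq] [Fintype Fq] {L : Type*} [Field L] [Algebra Fq L] {t : L}

local notation "q" => Fintype.card Fq

variable (ht : Function.Injective (aeval t : Fq[X] →ₐ[Fq] L))

include ht

/-- The recursion for the coefficients of `C_a` makes them polynomials in `a` without constant term,
uniformly in `a`. The factor `a` cancels the denominator in `L_k`. -/
theorem exists_polynomial_aeval_carlitzCoeff (e : ℕ) :
    ∃ h : L[X], ∀ a : Fq[X], aeval t (carlitzCoeff a e) = aeval t a * h.eval (aeval t a) := by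
  induction e with
  | zero => exact ⟨1, fun a => by simp [carlitzCoeff_zero]⟩
  | succ e ih =>
    obtain ⟨h, hh⟩ := ih
    have hne : t ^ q ^ (e + 1) - t ≠ 0 := by
      have := carlitzD_ne_zero ht (e + 1)
      rw [carlitzD] at this
      exact left_ne_zero_of_mul this
    refine ⟨C (t ^ q ^ (e + 1) - t)⁻¹ * (X ^ (q - 1) * h ^ q - h), fun a => ?_⟩
    have h1 := congrArg (aeval t) (sub_mul_carlitzCoeff_succ a e)
    simp only [map_sub, map_mul, map_pow, aeval_X] at h1
    rw [← mul_right_inj' hne, h1, hh]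
    simp only [eval_mul, eval_C, eval_sub, eval_pow, eval_X]
    have hq : aeval t a ^ q = aeval t a * aeval t a ^ (q - 1) := by
      rw [← pow_succ', Nat.sub_add_cancel (card_field_pos Fq)]
    rw [mul_pow, hq]
    field_simp

theorem sum_monicOfDegree_mul_prod_carlitz_eq_zero {s : ℕ} (hs : s ≠ 0) (hqs : q - 1 ∣ s)
    {h : L[X]} {e : ℕ}
    (hh : ∀ a : Fq[X], aeval t (carlitzCoeff a e) = aeval t a * h.eval (aeval t a))
    {M : ℕ} (hM : h.natDegree + s < M) :
    ∑ k ∈ Finset.range M, ∑ a ∈ monicOfDegree Fq k, MvPolynomial.C (h.eval (aeval t a)) *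
      ∏ j : Fin s, carlitz Fq (MvPolynomial.C t) a
        (MvPolynomial.X (j + 1 : ℕ) : MvPolynomial ℕ L) = 0 := by
  rw [sum_range_sum_monicOfDegree]
  · have : Nonempty (Fin s) := ⟨⟨0, Nat.pos_of_ne_zero hs⟩⟩
    simp only [map_zero, LinearMap.zero_apply, Finset.prod_const, Finset.card_univ,
      Fintype.card_fin, zero_pow hs, mul_zero, zero_sub, neg_eq_zero]
    simp only [eval_eq_sum_range, map_sum, Finset.sum_mul]
    rw [Finset.sum_comm]
    refine Finset.sum_eq_zero fun m hm => ?_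
    rw [Finset.mem_range] at hm
    -- The summand `a ^ m ∏ C_a(X_{j+1})` is a product of `m + s` forms linear in the `M`
    -- coefficients of `a`, and `m + s < M`.
    have key := sum_prod_linear_eq_zero (Fq := Fq) (n := M) (fun l => Sum.elim
      (fun _ : Fin m => (MvPolynomial.C (t ^ (l : ℕ)) : MvPolynomial ℕ L))
      (fun j : Fin s => carlitz Fq (MvPolynomial.C t) (X ^ (l : ℕ)) (MvPolynomial.X (j + 1 : ℕ))))
      Finset.univ (by simp; omega)
    rw [← mul_zero (MvPolynomial.C (h.coeff m)), ← key, Finset.mul_sum]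
    refine Finset.sum_congr rfl fun c _ => ?_
    rw [Fintype.prod_sum_type]
    simp only [Sum.elim_inl, Sum.elim_inr, Finset.prod_const, Finset.card_univ, Fintype.card_fin]
    rw [map_mul, mul_assoc, map_pow]
    congr 2
    · congr 1
      simp only [map_sum]
      refine Finset.sum_congr rfl fun l _ => ?_
      rw [map_smul, aeval_X_pow]
      exact map_smul (IsScalarTower.toAlgHom Fq L (MvPolynomial ℕ L)) (c l) (t ^ (l : ℕ))
    · refine Finset.prod_congr rfl fun j _ => ?_
      simp only [LinearMap.sum_apply, map_smul, LinearMap.smul_apply]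
  · intro ζ a hζ
    congr 1
    · rcases eq_or_ne a 0 with rfl | ha
      · simp
      · congr 1
        -- Linearity of the coefficient of `C_a` gives `h(ζ a) = h(a)` after cancelling `ζ a`; the
        -- remaining product scales by `ζ ^ s = 1`.
        have h1 := hh (ζ • a)
        rw [carlitzCoeff_smul, map_smul, hh, map_smul, smul_mul_assoc] at h1
        exact (mul_left_cancel₀ (aeval_ne_zero_of_injective ht ha)
          (smul_right_injective L hζ h1)).symm ▸ by rw [map_smul]
    · simp only [map_smul, LinearMap.smul_apply]
      rw [Finset.prod_smul]
      simp only [Finset.prod_const, Finset.card_univ, Fintype.card_fin]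
      obtain ⟨m, rfl⟩ := hqs
      rw [pow_mul, FiniteField.pow_card_sub_one_eq_one ζ hζ, one_pow, one_smul]

theorem X_pow_dvd_sum_Lcoeff {s : ℕ} (hs : s ≠ 0) (hqs : q - 1 ∣ s) (B : ℕ) :
    ∀ᶠ M in Filter.atTop, (MvPolynomial.X 0 : MvPolynomial ℕ L) ^ q ^ B ∣
      ∑ k ∈ Finset.range M, Lcoeff Fq t (∏ j ∈ Finset.range (s + 1), MvPolynomial.X j) k := by
  choose h hh using exists_polynomial_aeval_carlitzCoeff ht
  have hev : ∀ᶠ M in Filter.atTop, ∀ e ∈ Finset.range B, (h e).natDegree + s < M :=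
    (Finset.eventually_all _).2 fun e _ => Filter.eventually_gt_atTop _
  filter_upwards [hev] with M hM
  let Y (a : Fq[X]) : MvPolynomial ℕ L := ∏ j : Fin s, carlitz Fq (MvPolynomial.C t) a
        (MvPolynomial.X (j + 1 : ℕ) : MvPolynomial ℕ L)
  -- This is the part of the sum of degree less than `q ^ B` in the first variable, coming from the
  -- terms `τ ^ e`, `e < B`, of `C_a(X_1)`. Subtracting it leaves only multiples of `X_1 ^ (q ^ B)`.
  have hzero : ∑ e ∈ Finset.range B, (MvPolynomial.X 0 : MvPolynomial ℕ L) ^ q ^ e *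
      ∑ k ∈ Finset.range M, ∑ a ∈ monicOfDegree Fq k,
        MvPolynomial.C ((h e).eval (aeval t a)) * Y a = 0 :=
    Finset.sum_eq_zero fun e he => by
      rw [sum_monicOfDegree_mul_prod_carlitz_eq_zero ht hs hqs (hh e) (hM e he), mul_zero]
  have hL : ∀ k, Lcoeff Fq t (∏ j ∈ Finset.range (s + 1), MvPolynomial.X j) k =
      ∑ a ∈ monicOfDegree Fq k, MvPolynomial.C (aeval t a)⁻¹ *
        (Y a * carlitz Fq (MvPolynomial.C t) a (MvPolynomial.X 0 : MvPolynomial ℕ L)) := fun k => by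
    refine Finset.sum_congr rfl fun a _ => ?_
    rw [starAction_eq, map_prod, Finset.prod_range_succ', Finset.prod_range]
    simp only [starHom_X]
    rfl
  rw [← sub_zero (∑ k ∈ Finset.range M, _), ← hzero]
  simp only [hL, Finset.mul_sum]
  rw [Finset.sum_comm, ← Finset.sum_sub_distrib]
  refine Finset.dvd_sum fun k _ => ?_
  rw [Finset.sum_comm, ← Finset.sum_sub_distrib]
  refine Finset.dvd_sum fun a ha => ?_
  have ha0 : aeval t a ≠ 0 := aeval_ne_zero_of_injective ht (mem_monicOfDegree.1 ha).1.ne_zero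
  rw [carlitz_apply_of_lt (N := B + (a.natDegree + 1)) _ _ (by omega), Finset.sum_range_add,
    mul_add, mul_add, add_sub_right_comm]
  refine dvd_add ?_ ?_
  · convert dvd_zero _
    rw [sub_eq_zero, Finset.mul_sum, Finset.mul_sum]
    refine Finset.sum_congr rfl fun e _ => ?_
    rw [← MvPolynomial.algebraMap_eq, aeval_algebraMap_apply, MvPolynomial.algebraMap_eq, hh e,
      map_mul]
    have hinv : (MvPolynomial.C (aeval t a)⁻¹ : MvPolynomial ℕ L) * MvPolynomial.C (aeval t a) = 1 := by
      rw [← map_mul, inv_mul_cancel₀ ha0, map_one]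
    linear_combination (MvPolynomial.X 0 ^ q ^ e * MvPolynomial.C ((h e).eval (aeval t a)) * Y a) *
      hinv
  · refine Dvd.dvd.mul_left (Dvd.dvd.mul_left (Finset.dvd_sum fun e _ => Dvd.dvd.mul_left ?_ _) _) _
    exact pow_dvd_pow _ (Nat.pow_le_pow_right (card_field_pos Fq) (Nat.le_add_right _ _))

omit ht in
theorem sum_logAlgCoeff (F : MvPolynomial ℕ L) (N : ℕ) :
    ∑ n ∈ Finset.range N, logAlgCoeff Fq t F n = ∑ i ∈ Finset.range N,
      MvPolynomial.C (carlitzD Fq t i)⁻¹ *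
        (∑ k ∈ Finset.range (N - i), Lcoeff Fq t F k) ^ q ^ i := by
  simp only [logAlgCoeff, expSeq_apply, sum_pow_card_pow, Finset.mul_sum]
  exact Finset.sum_sigma' .. |>.trans (by
    rw [Finset.sum_sigma']
    refine Finset.sum_bij' (fun x _ => ⟨x.2, x.1 - x.2⟩) (fun x _ => ⟨x.1 + x.2, x.1⟩)
      ?_ ?_ ?_ ?_ ?_
    all_goals
      rintro ⟨a, b⟩ h
      simp only [Finset.mem_sigma, Finset.mem_range] at h ⊢
    · omega
    · omega
    · congr 1; omega
    · congr 1; omega)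

/-- A nonzero polynomial cannot be divisible by `X_1 ^ (q ^ B)` for all `B`. -/
theorem specialPoly_eq_zero {s : ℕ} (hs : s ≠ 0) (hqs : q - 1 ∣ s) :
    specialPoly Fq t (s + 1) = 0 := by
  have hq : 1 < q := Fintype.one_lt_card
  have hdvd : ∀ B : ℕ, (MvPolynomial.X 0 : MvPolynomial ℕ L) ^ q ^ B ∣
      specialPoly Fq t (s + 1) := fun B => by
    obtain ⟨M, hM⟩ := Filter.eventually_atTop.1 (X_pow_dvd_sum_Lcoeff ht hs hqs B)
    -- The number of terms may be taken as large as desired. Then for each `i` either the inner sum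
    -- of the `L_k` has at least `M` terms and is itself divisible, or `i ≥ B` and the power `q ^ i`
    -- of the obvious factor `X_1` suffices.
    rw [specialPoly_eq_sum ht (show s + 1 < (s + 2) + M + B by omega), sum_logAlgCoeff]
    refine Finset.dvd_sum fun i hi => Dvd.dvd.mul_left ?_ _
    by_cases hiM : M ≤ (s + 2) + M + B - i
    · exact (hM _ hiM).trans (dvd_pow_self _ (pow_pos (card_field_pos Fq) i).ne')
    · refine (pow_dvd_pow _ (Nat.pow_le_pow_right (card_field_pos Fq)
        (show B ≤ i by omega))).trans (pow_dvd_pow_of_dvd ?_ _)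
      refine Finset.dvd_sum fun k _ => Finset.dvd_sum fun a _ => Dvd.dvd.mul_left ?_ _
      rw [starAction_eq, map_prod]
      refine Dvd.dvd.trans ?_ (Finset.dvd_prod_of_mem _ (Finset.mem_range.2 (Nat.succ_pos s)))
      rw [starHom_X, carlitz_apply]
      exact Finset.dvd_sum fun e _ => Dvd.dvd.mul_left
        (dvd_pow_self _ (pow_pos (card_field_pos Fq) e).ne') _
  by_contra hne
  obtain ⟨g, hg⟩ := hdvd (specialPoly Fq t (s + 1)).totalDegree
  have h1 := congrArg MvPolynomial.totalDegree hg
  have hg0 : g ≠ 0 := by rintro rfl; exact hne (by rw [hg, mul_zero])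
  rw [MvPolynomial.totalDegree_mul_of_isDomain (pow_ne_zero _ (MvPolynomial.X_ne_zero 0)) hg0,
    MvPolynomial.totalDegree_X_pow] at h1
  have := Nat.lt_pow_self (n := (specialPoly Fq t (s + 1)).totalDegree) hq
  omega

end TrivialZeros

/-! ### Torsion and divisibility in `C(ℜ)` -/

section Divisibility

variable {Fq : Type*} [Field Fq] [Fintype Fq] {L : Type*} [Field L] [Algebra Fq L] {t : L}

local notation "q" => Fintype.card Fq

omit [Fintype Fq] in
theorem aeval_C_eq (a : Fq[X]) :
    aeval (MvPolynomial.C t : MvPolynomial ℕ L) a = MvPolynomial.C (aeval t a) := by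
  rw [← MvPolynomial.algebraMap_eq, aeval_algebraMap_apply]

/-- If `r` had positive total degree, the top term `r ^ (q ^ deg a)` of `C_a(r)` could not be
cancelled by the others. -/
theorem eq_C_of_carlitz_eq_zero {a : Fq[X]} (ha : a ≠ 0) {r : MvPolynomial ℕ L}
    (h : carlitz Fq (MvPolynomial.C t) a r = 0) :
    ∃ x : L, r = MvPolynomial.C x ∧ carlitz Fq t a x = 0 := by
  have hq : 1 < q := Fintype.one_lt_card
  have hdeg : r.totalDegree = 0 := by
    by_contra hd
    have hr : r ≠ 0 := by rintro rfl; exact hd MvPolynomial.totalDegree_zero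
    rw [carlitz_apply, Finset.sum_range_succ, carlitzCoeff_natDegree, aeval_C_eq, aeval_C,
      ← neg_eq_iff_add_eq_zero] at h
    have hc : MvPolynomial.C (σ := ℕ) (algebraMap Fq L a.leadingCoeff) ≠ 0 := by
      simpa using ha
    have hpow : ∀ i, (r ^ i).totalDegree = i * r.totalDegree := fun i => by
      induction i with
      | zero => simp
      | succ i ih =>
        rw [pow_succ, MvPolynomial.totalDegree_mul_of_isDomain (pow_ne_zero _ hr) hr, ih]
        ring
    have h1 := congrArg MvPolynomial.totalDegree h
    rw [MvPolynomial.totalDegree_neg,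
      MvPolynomial.totalDegree_mul_of_isDomain hc (pow_ne_zero _ hr), MvPolynomial.totalDegree_C,
      zero_add, hpow] at h1
    have h2 : (∑ j ∈ Finset.range a.natDegree, aeval (MvPolynomial.C t : MvPolynomial ℕ L)
        (carlitzCoeff a j) * r ^ q ^ j).totalDegree ≤
          (q ^ a.natDegree - 1) * r.totalDegree := by
      refine MvPolynomial.totalDegree_finsetSum_le fun j hj => ?_
      refine (MvPolynomial.totalDegree_mul _ _).trans ?_
      rw [aeval_C_eq, MvPolynomial.totalDegree_C, zero_add, hpow]
      exact Nat.mul_le_mul_right _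
        (Nat.le_sub_one_of_lt (Nat.pow_lt_pow_right hq (Finset.mem_range.1 hj)))
    rw [h1, Nat.sub_mul, one_mul] at h2
    have h3 : 1 * r.totalDegree ≤ q ^ a.natDegree * r.totalDegree :=
      Nat.mul_le_mul_right _ (Nat.one_le_pow _ _ (by omega))
    omega
  obtain hx := MvPolynomial.totalDegree_eq_zero_iff_eq_C.1 hdeg
  refine ⟨_, hx, MvPolynomial.C_injective ℕ L ?_⟩
  rw [map_zero, ← h]
  conv_rhs => rw [hx]
  exact map_carlitz (IsScalarTower.toAlgHom Fq L (MvPolynomial ℕ L)) t _ a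

theorem pderiv_pow_card_pow (i : ℕ) (k : ℕ) (f : MvPolynomial ℕ L) :
    MvPolynomial.pderiv i (f ^ q ^ (k + 1)) = 0 := by
  have h0 : ((q : ℕ) : MvPolynomial ℕ L) = 0 := by
    rw [← map_natCast (algebraMap Fq (MvPolynomial ℕ L)), FiniteField.cast_card_eq_zero, map_zero]
  rw [MvPolynomial.pderiv_pow, Nat.cast_pow, h0, zero_pow (Nat.succ_ne_zero k), zero_mul, zero_mul]

theorem pderiv_carlitz (i : ℕ) (a : Fq[X]) (x : MvPolynomial ℕ L) :
    MvPolynomial.pderiv i (carlitz Fq (MvPolynomial.C t) a x) =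
      MvPolynomial.C (aeval t a) * MvPolynomial.pderiv i x := by
  rw [carlitz_apply, Finset.sum_range_succ', map_add, map_sum, Finset.sum_eq_zero, zero_add,
    carlitzCoeff_zero, aeval_C_eq, MvPolynomial.pderiv_C_mul, pow_zero, pow_one]
  intro j _
  rw [aeval_C_eq, MvPolynomial.pderiv_C_mul, pderiv_pow_card_pow, mul_zero]

theorem pderiv_logAlgCoeff (i : ℕ) (F : MvPolynomial ℕ L) (n : ℕ) :
    MvPolynomial.pderiv i (logAlgCoeff Fq t F n) = MvPolynomial.pderiv i (Lcoeff Fq t F n) := by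
  rw [logAlgCoeff, expSeq_apply, Finset.sum_range_succ', map_add, map_sum, Finset.sum_eq_zero]
  · simp [carlitzD]
  · intro j _
    rw [MvPolynomial.pderiv_C_mul, pderiv_pow_card_pow, mul_zero]

/-- The hypothesis says that `C_θ(x) = c x`, so `A` acts on the line of `x` through evaluation at
`c`. -/
theorem carlitz_eigenvector {c : Fq} {x : L} (hx : x ^ (q - 1) = algebraMap Fq L c - t)
    (a : Fq[X]) : carlitz Fq t a x = a.eval c • x := by
  induction a using polynomial_induction_X_mul with
  | one => simp
  | add a b ha hb => rw [map_add, LinearMap.add_apply, ha, hb, eval_add, add_smul]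
  | smul d a ha => rw [map_smul, LinearMap.smul_apply, ha, eval_smul, smul_assoc]
  | X_mul a ha =>
    have hxq : x ^ q = (algebraMap Fq L c - t) * x := by
      rw [← hx, ← pow_succ, Nat.sub_add_cancel (card_field_pos Fq)]
    rw [carlitz_X_mul, ha, smul_pow_card, eval_mul, eval_X]
    simp only [Algebra.smul_def, map_mul]
    linear_combination algebraMap Fq L (a.eval c) * hxq

variable (ht : Function.Injective (aeval t : Fq[X] →ₐ[Fq] L))

include ht

/-- Differentiation keeps only the `i = 0` term of `exp_C` and turns `C_a(X_1) / a` into `1`. At the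
eigenvector the sum over degree `n` becomes `x ^ s ∑ a(c) ^ s`, a power sum over `𝔽_q` that vanishes
for `n > 0`. -/
theorem aeval_pderiv_specialPoly {s : ℕ} (hs : s = 0 ∨ ¬ q - 1 ∣ s) {c : Fq} {x : L}
    (hx : x ^ (q - 1) = algebraMap Fq L c - t) :
    MvPolynomial.aeval (fun _ => x)
      (MvPolynomial.pderiv 0 (specialPoly Fq t (s + 1))) = x ^ s := by
  have key : ∀ n, MvPolynomial.aeval (fun _ => x) (MvPolynomial.pderiv 0
      (logAlgCoeff Fq t (∏ j ∈ Finset.range (s + 1), MvPolynomial.X j) n)) =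
        (if n = 0 then (1 : Fq) else 0) • x ^ s := fun n => by
    rw [pderiv_logAlgCoeff, Lcoeff, map_sum, map_sum, ← sum_monicOfDegree_eval_pow hs c n,
      Finset.sum_smul]
    refine Finset.sum_congr rfl fun a ha => ?_
    have ha0 : aeval t a ≠ 0 :=
      aeval_ne_zero_of_injective ht (mem_monicOfDegree.1 ha).1.ne_zero
    have h0 : MvPolynomial.pderiv 0 (∏ j ∈ Finset.range s,
        carlitz Fq (MvPolynomial.C t) a (MvPolynomial.X (j + 1) : MvPolynomial ℕ L)) = 0 := by
      refine Finset.prod_induction _ (fun f => MvPolynomial.pderiv 0 f = 0) ?_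
        MvPolynomial.pderiv_one ?_
      · intro f g hf hg
        rw [MvPolynomial.pderiv_mul, hf, hg, zero_mul, mul_zero, add_zero]
      · intro j _
        rw [pderiv_carlitz, MvPolynomial.pderiv_X_of_ne (Nat.succ_ne_zero j), mul_zero]
    rw [starAction_eq, map_prod, Finset.prod_range_succ', MvPolynomial.pderiv_C_mul]
    simp only [starHom_X]
    rw [MvPolynomial.pderiv_mul, h0, zero_mul, zero_add, pderiv_carlitz,
      MvPolynomial.pderiv_X_self, mul_one, mul_comm, mul_assoc, ← map_mul, mul_inv_cancel₀ ha0,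
      map_one, mul_one, map_prod]
    have h1 : ∀ j, MvPolynomial.aeval (fun _ : ℕ => x)
        (carlitz Fq (MvPolynomial.C t) a (MvPolynomial.X j : MvPolynomial ℕ L)) =
          a.eval c • x := fun j => by
      rw [← carlitz_eigenvector hx]
      have := map_carlitz ((MvPolynomial.aeval (R := L) fun _ : ℕ => x).restrictScalars Fq)
        (MvPolynomial.C t) (MvPolynomial.X j) a
      simpa using this
    simp only [h1, Finset.prod_const, Finset.card_range, _root_.smul_pow]
  rw [specialPoly_eq_sum ht (Nat.lt_succ_self _), map_sum, map_sum]
  simp only [key]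
  rw [← Finset.sum_smul]
  simp

omit [Fintype Fq] in
theorem dvd_of_isIntegralElem {w : L} (hw : (aeval t : Fq[X] →ₐ[Fq] L).toRingHom.IsIntegralElem w)
    {u v : Fq[X]} (hu : u ≠ 0) (h : aeval t u * w = aeval t v) : u ∣ v := by
  let : Algebra Fq[X] L := (aeval t : Fq[X] →ₐ[Fq] L).toRingHom.toAlgebra
  have : FaithfulSMul Fq[X] L := (faithfulSMul_iff_algebraMap_injective _ _).2 ht
  let := FractionRing.liftAlgebra Fq[X] L
  have hut : algebraMap Fq[X] L u ≠ 0 := aeval_ne_zero_of_injective ht hu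
  have hu' : algebraMap Fq[X] (FractionRing Fq[X]) u ≠ 0 := by simpa using hu
  have hw' : algebraMap (FractionRing Fq[X]) L
      (algebraMap _ _ v / algebraMap _ _ u) = w := by
    rw [map_div₀, ← IsScalarTower.algebraMap_apply, ← IsScalarTower.algebraMap_apply,
      div_eq_iff hut, mul_comm]
    exact h.symm
  have hint : IsIntegral Fq[X] w := hw
  rw [← hw', isIntegral_algebraMap_iff (algebraMap (FractionRing Fq[X]) L).injective,
    IsIntegrallyClosed.isIntegral_iff] at hint
  obtain ⟨y, hy⟩ := hint
  rw [eq_div_iff hu', ← map_mul] at hy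
  exact ⟨y, by rw [mul_comm, IsFractionRing.injective Fq[X] (FractionRing Fq[X]) hy]⟩

omit ht in
attribute [local instance] MvPolynomial.algebraMvPolynomial in
-- For monic `a` the equation `C_a(r) = f` is a monic equation for `r` over `A[X_1, X_2, …]`, and a
-- polynomial integral over that ring has coefficients integral over `A`.
theorem isIntegralElem_coeff_of_carlitz_eq {a : Fq[X]} (ha : a.Monic) {r f : MvPolynomial ℕ L}
    (hf : f ∈ (MvPolynomial.mapAlgHom (σ := ℕ) (aeval t : Fq[X] →ₐ[Fq] L)).range)
    (h : carlitz Fq (MvPolynomial.C t) a r = f) (m : ℕ →₀ ℕ) :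
    (aeval t : Fq[X] →ₐ[Fq] L).toRingHom.IsIntegralElem (r.coeff m) := by
  let : Algebra Fq[X] L := (aeval t : Fq[X] →ₐ[Fq] L).toRingHom.toAlgebra
  obtain ⟨f, rfl⟩ := hf
  have hint : IsIntegral (MvPolynomial ℕ Fq[X]) r := by
    let p : (MvPolynomial ℕ Fq[X])[X] := ∑ j ∈ Finset.range a.natDegree,
      C (MvPolynomial.C (carlitzCoeff a j)) * X ^ q ^ j - C f
    have hp : p ∈ degreeLT (MvPolynomial ℕ Fq[X]) (q ^ a.natDegree) := by
      refine Submodule.sub_mem (degreeLT _ _) ?_ ?_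
      · refine Submodule.sum_mem (degreeLT _ _) fun j hj => ?_
        rw [mem_degreeLT]
        refine (degree_C_mul_X_pow_le _ _).trans_lt ?_
        exact_mod_cast Nat.pow_lt_pow_right Fintype.one_lt_card (Finset.mem_range.1 hj)
      · rw [mem_degreeLT]
        refine degree_C_le.trans_lt ?_
        exact_mod_cast pow_pos (card_field_pos Fq) _
    refine ⟨X ^ q ^ a.natDegree + p, monic_X_pow_add (mem_degreeLT.1 hp), ?_⟩
    have h' := h
    rw [carlitz_apply, Finset.sum_range_succ, carlitzCoeff_natDegree, ha.leadingCoeff, map_one,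
      map_one, one_mul] at h'
    simp only [p, eval₂_add, eval₂_sub, eval₂_pow, eval₂_X, eval₂_finsetSum, eval₂_mul, eval₂_C]
    rw [add_sub, sub_eq_zero, add_comm]
    refine Eq.trans ?_ h'
    congr 1
    refine Finset.sum_congr rfl fun j _ => ?_
    rw [aeval_C_eq, MvPolynomial.algebraMap_def, MvPolynomial.map_C]
    rfl
  exact MvPolynomial.isIntegral_iff_isIntegral_coeff.1 hint m

theorem dvd_of_carlitz_eq_carlitz_specialPoly {s : ℕ} (hs : s = 0 ∨ ¬ q - 1 ∣ s)
    (hroot : ∀ c : Fq, ∃ x : L, x ^ (q - 1) = algebraMap Fq L c - t) {a b : Fq[X]} (ha : a.Monic)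
    {r : MvPolynomial ℕ L} (h : carlitz Fq (MvPolynomial.C t) a r =
      carlitz Fq (MvPolynomial.C t) b (specialPoly Fq t (s + 1))) : a ∣ b := by
  have hq : 1 < q := Fintype.one_lt_card
  -- Differentiating and evaluating gives `a y = b x ^ s` with `y` integral; the power `q - 1`
  -- replaces `x` by `c - θ` and brings the relation back to `A`.
  have hdvd : ∀ c : Fq, a ^ (q - 1) ∣ b ^ (q - 1) * (C c - X) ^ s := fun c => by
    obtain ⟨x, hx⟩ := hroot c
    let : Algebra Fq[X] L := (aeval t : Fq[X] →ₐ[Fq] L).toRingHom.toAlgebra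
    have hxint : IsIntegral Fq[X] x := by
      refine IsIntegral.of_pow (n := q - 1) (by omega) ?_
      rw [hx]
      convert isIntegral_algebraMap (R := Fq[X]) (A := L) (x := C c - X)
      change _ = aeval t (C c - X)
      simp
    have hf : carlitz Fq (MvPolynomial.C t) b (specialPoly Fq t (s + 1)) ∈
        (MvPolynomial.mapAlgHom (σ := ℕ) (aeval t : Fq[X] →ₐ[Fq] L)).range := by
      obtain ⟨f, hf⟩ := specialPoly_mem_range_map ht (s + 1)
      refine ⟨carlitz Fq (MvPolynomial.C X) b f, ?_⟩
      simp only [AlgHom.toRingHom_eq_coe, RingHom.coe_coe] at hf ⊢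
      rw [map_carlitz, hf]
      simp
    have hr := isIntegralElem_coeff_of_carlitz_eq ha hf h
    set y := MvPolynomial.aeval (fun _ => x) (MvPolynomial.pderiv 0 r)
    have hy : y ∈ integralClosure Fq[X] L := by
      refine MvPolynomial.eval₂_mem (fun m _ => ?_) fun _ => hxint
      rw [MvPolynomial.coeff_pderiv]
      refine mul_mem (hr _) ?_
      exact_mod_cast natCast_mem (integralClosure Fq[X] L) (m 0 + 1)
    have hxy : aeval t a * y = aeval t b * x ^ s := by
      have := congrArg (fun f => MvPolynomial.aeval (fun _ => x) (MvPolynomial.pderiv 0 f)) h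
      simp only [pderiv_carlitz, map_mul, aeval_pderiv_specialPoly ht hs hx,
        MvPolynomial.algHom_C, Algebra.algebraMap_self, RingHom.id_apply] at this
      exact this
    refine dvd_of_isIntegralElem ht (w := y ^ (q - 1))
      (show IsIntegral Fq[X] (y ^ (q - 1)) from IsIntegral.pow hy _) (pow_ne_zero _ ha.ne_zero) ?_
    rw [map_pow, ← mul_pow, hxy, mul_pow, ← pow_mul, mul_comm s, pow_mul, hx]
    simp
  -- Two values of `c` are enough: `-θ` and `1 - θ` are coprime.
  have hco : IsCoprime ((C (0 : Fq) - X) ^ s) ((C (1 : Fq) - X) ^ s) :=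
    IsCoprime.pow ⟨-1, 1, by simp⟩
  have h1 : a ^ (q - 1) ∣ b ^ (q - 1) := by
    obtain ⟨u, v, huv⟩ := hco
    have := dvd_add ((hdvd 0).mul_left u) ((hdvd 1).mul_left v)
    have he : u * (b ^ (q - 1) * (C (0 : Fq) - X) ^ s) +
        v * (b ^ (q - 1) * (C (1 : Fq) - X) ^ s) = b ^ (q - 1) := by
      linear_combination b ^ (q - 1) * huv
    rwa [he] at this
  exact (IsIntegrallyClosed.pow_dvd_pow_iff (by omega)).1 h1

end Divisibility

/-! ### The radical of the module of special polynomials -/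

section Radical

variable {Fq : Type*} [Field Fq] [Fintype Fq] {L : Type*} [Field L] [Algebra Fq L] {t : L}

local notation "q" => Fintype.card Fq

variable (L) in
/-- The substitution `X_j ↦ 0` for `j > s`. -/
def truncVars (s : ℕ) : MvPolynomial ℕ L →ₐ[L] MvPolynomial ℕ L :=
  MvPolynomial.aeval fun j => if j < s then MvPolynomial.X j else 0

variable (ht : Function.Injective (aeval t : Fq[X] →ₐ[Fq] L))

include ht

/-- When `i > s`, every `a * (X_1 ⋯ X_i)` contains the factor `C_a(X_{s+1})`, which becomes `C_a(0)
= 0`. -/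
theorem truncVars_specialPoly (s i : ℕ) :
    truncVars L s (specialPoly Fq t i) = if i ≤ s then specialPoly Fq t i else 0 := by
  have hL : ∀ k, truncVars L s (Lcoeff Fq t (∏ j ∈ Finset.range i, MvPolynomial.X j) k) =
      if i ≤ s then Lcoeff Fq t (∏ j ∈ Finset.range i, MvPolynomial.X j) k else 0 := fun k => by
    have hstar : ∀ a : Fq[X], truncVars L s (starAction Fq t a
        (∏ j ∈ Finset.range i, MvPolynomial.X j)) =
        if i ≤ s then starAction Fq t a (∏ j ∈ Finset.range i, MvPolynomial.X j) else 0 := by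
      intro a
      simp only [starAction_eq, map_prod, starHom_X, algHom_carlitz]
      split_ifs with h
      · refine Finset.prod_congr rfl fun j hj => ?_
        rw [Finset.mem_range] at hj
        rw [truncVars, MvPolynomial.aeval_X, if_pos (by omega)]
      · refine Finset.prod_eq_zero (Finset.mem_range.2 (show s < i by omega)) ?_
        rw [truncVars, MvPolynomial.aeval_X, if_neg (lt_irrefl s), map_zero]
    rw [Lcoeff, map_sum]
    simp only [map_mul, MvPolynomial.algHom_C, MvPolynomial.algebraMap_eq, hstar]
    split_ifs
    · rfl
    · simp
  rw [specialPoly_eq_sum ht (Nat.lt_succ_self i), map_sum]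
  simp only [logAlgCoeff, map_expSeq, hL]
  split_ifs
  · rfl
  · exact Finset.sum_eq_zero fun n _ => congrFun (map_zero (expSeq Fq t)) n

/-- Every term of the relation is separately divisible by `a`. The bound `s < N` stands inside the
existential so that the `b` can be chosen as a function of all `s`. -/
theorem exists_carlitz_eq_carlitz_carlitz_specialPoly
    (hroot : ∀ c : Fq, ∃ x : L, x ^ (q - 1) = algebraMap Fq L c - t) {a : Fq[X]} (ha : a.Monic)
    {r : MvPolynomial ℕ L} {N : ℕ} {c : ℕ → Fq[X]}
    (h : carlitz Fq (MvPolynomial.C t) a r = ∑ i ∈ Finset.range N,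
      carlitz Fq (MvPolynomial.C t) (c i) (specialPoly Fq t (i + 1))) (s : ℕ) :
    ∃ b : Fq[X], s < N → carlitz Fq (MvPolynomial.C t) (c s) (specialPoly Fq t (s + 1)) =
      carlitz Fq (MvPolynomial.C t) a
        (carlitz Fq (MvPolynomial.C t) b (specialPoly Fq t (s + 1))) := by
  induction s using Nat.strong_induction_on with
  | _ s ih =>
    by_cases hsN : s < N
    swap
    · exact ⟨0, fun h => absurd h hsN⟩
    by_cases hs : s = 0 ∨ ¬ q - 1 ∣ s
    swap
    · push Not at hs
      -- Here `c s` need not be divisible by `a`, but `𝕊_{s+1}` vanishes and `b = 0` works.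
      exact ⟨0, fun _ => by simp [specialPoly_eq_zero ht hs.1 hs.2]⟩
    have hsum : carlitz Fq (MvPolynomial.C t) a (truncVars L (s + 1) r) =
        ∑ i ∈ Finset.range (s + 1),
          carlitz Fq (MvPolynomial.C t) (c i) (specialPoly Fq t (i + 1)) := by
      rw [← algHom_carlitz, h, map_sum]
      simp only [algHom_carlitz, truncVars_specialPoly ht]
      symm
      refine Finset.sum_subset_zero_on_sdiff (Finset.range_mono hsN) ?_ ?_
      · intro i hi
        simp only [Finset.mem_sdiff, Finset.mem_range] at hi
        rw [if_neg (by omega), map_zero]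
      · intro i hi
        rw [Finset.mem_range] at hi
        rw [if_pos (by omega)]
    choose! b hb using ih
    -- The earlier terms are moved inside `C_a`, leaving a single special polynomial on the right.
    rw [Finset.sum_range_succ, Finset.sum_congr rfl fun i hi =>
        hb i (Finset.mem_range.1 hi) ((Finset.mem_range.1 hi).trans hsN), ← map_sum,
      ← sub_eq_iff_eq_add', ← map_sub] at hsum
    obtain ⟨b, hb⟩ := dvd_of_carlitz_eq_carlitz_specialPoly ht hs hroot ha hsum
    exact ⟨b, fun _ => by rw [hb, carlitz_mul]⟩

end Radical

/-! ### The radical over `ℂ_∞` -/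

section Cinf

variable (Fq : Type*) [Field Fq] [Fintype Fq]

/-- The equation is defined over `K`, so a root already exists in the algebraic closure of `K_∞`. -/
theorem Cinf.exists_pow_eq (c : Fq) :
    ∃ x : Cinf Fq, x ^ (Fintype.card Fq - 1) = algebraMap Fq (Cinf Fq) c - Cinf.theta Fq := by
  have hq : 1 < Fintype.card Fq := Fintype.one_lt_card
  let ι : KinfBar Fq →+* Cinf Fq :=
    (UniformSpace.Completion.coeRingHom : KinfBar Fq →+* UniformSpace.Completion (KinfBar Fq))
  obtain ⟨x, hx⟩ := IsAlgClosed.exists_pow_nat_eq (algebraMap (Kinf Fq) (KinfBar Fq)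
    (algebraMap (RatFunc Fq) (Kinf Fq) (algebraMap Fq (RatFunc Fq) c - RatFunc.X)))
    (show 0 < Fintype.card Fq - 1 by omega)
  refine ⟨ι x, ?_⟩
  rw [← map_pow, hx]
  exact map_sub (Cinf.ofK Fq) _ _

theorem specialModule_eq_span_range : specialModule Fq = Submodule.span Fq[X]
    (Set.range fun s : ℕ => toCRing Fq (specialPoly Fq (Cinf.theta Fq) (s + 1))) := by
  rw [specialModule]
  congr 1
  ext f
  constructor
  · rintro ⟨s, hs, rfl⟩
    exact ⟨s - 1, by simp only [Nat.sub_add_cancel hs]⟩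
  · rintro ⟨s, rfl⟩
    exact ⟨s + 1, Nat.le_add_left 1 s, rfl⟩

theorem smul_toCRing (a : Fq[X]) (f : MvPolynomial ℕ (Cinf Fq)) :
    a • toCRing Fq f = toCRing Fq (carlitz Fq (MvPolynomial.C (Cinf.theta Fq)) a f) := rfl

theorem add_constTorsion_subset_sqrtSpecialModule :
    (specialModule Fq : Set (CRing Fq)) + constTorsion Fq ⊆ sqrtSpecialModule Fq := by
  rintro _ ⟨f, hf, _, ⟨x, ⟨a, ha, hx⟩, rfl⟩, rfl⟩
  refine ⟨a, ha, ?_⟩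
  have h0 : carlitz Fq (MvPolynomial.C (Cinf.theta Fq)) a
      (MvPolynomial.C x : MvPolynomial ℕ (Cinf Fq)) = 0 := by
    rw [← map_zero MvPolynomial.C, ← hx]
    exact (map_carlitz (IsScalarTower.toAlgHom Fq (Cinf Fq) (MvPolynomial ℕ (Cinf Fq)))
      (Cinf.theta Fq) x a).symm
  simp only [smul_add, smul_toCRing, h0, map_zero, add_zero]
  exact Submodule.smul_mem _ _ hf

theorem sqrtSpecialModule_subset_add_constTorsion :
    sqrtSpecialModule Fq ⊆ (specialModule Fq : Set (CRing Fq)) + constTorsion Fq := by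
  rintro r ⟨a, ha, har⟩
  wlog ham : a.Monic generalizing a
  -- Normalizing `a` is harmless because `𝔉` is stable under the scalars of `𝔽_q`; monicity is what
  -- makes the coefficients of `r` integral.
  · refine this (C a.leadingCoeff⁻¹ * a) (mul_ne_zero ?_ ha) ?_ ?_
    · simpa using ha
    · rw [mul_smul]
      exact Submodule.smul_mem _ _ har
    · rw [mul_comm]
      exact monic_mul_leadingCoeff_inv ha
  obtain ⟨r, rfl⟩ := (toCRing Fq).surjective r
  rw [specialModule_eq_span_range, Finsupp.mem_span_range_iff_exists_finsupp] at har
  obtain ⟨c, hc⟩ := har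
  obtain ⟨N, hN⟩ := c.support.exists_nat_subset_range
  rw [Finsupp.sum_of_support_subset _ hN _ (by simp)] at hc
  simp only [smul_toCRing, ← map_sum] at hc
  have hc := (toCRing Fq).injective hc
  choose b hb using exists_carlitz_eq_carlitz_carlitz_specialPoly (aeval_theta_injective Fq)
    (Cinf.exists_pow_eq Fq) ham hc.symm
  rw [Finset.sum_congr rfl fun i hi => hb i (Finset.mem_range.1 hi), ← map_sum, eq_comm,
    ← sub_eq_zero, ← map_sub] at hc
  obtain ⟨x, hx, hax⟩ := eq_C_of_carlitz_eq_zero ha hc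
  refine ⟨toCRing Fq (∑ i ∈ Finset.range N, carlitz Fq (MvPolynomial.C (Cinf.theta Fq)) (b i)
    (specialPoly Fq (Cinf.theta Fq) (i + 1))), ?_, _, ⟨x, ⟨a, ha, hax⟩, rfl⟩, ?_⟩
  · rw [SetLike.mem_coe, specialModule_eq_span_range, map_sum]
    refine sum_mem fun i _ => ?_
    rw [← smul_toCRing]
    exact Submodule.smul_mem _ _ (Submodule.subset_span ⟨i, rfl⟩)
  · simp only [← map_add, ← hx, add_sub_cancel]

end Cinf

end

theorem mainTheorem7 (Fq : Type*) [Field Fq] [Fintype Fq] :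
    (∀ s : ℕ, 1 ≤ s → ∃ P : Polynomial (MvPolynomial ℕ Fq[X]),
      ((P.map (MvPolynomial.map
          (aeval (Cinf.theta Fq) : Fq[X] →ₐ[Fq] Cinf Fq).toRingHom) :
        Polynomial (MvPolynomial ℕ (Cinf Fq))) : PowerSeries (MvPolynomial ℕ (Cinf Fq))) =
        specialSeries Fq (Cinf.theta Fq) s) ∧
    sqrtSpecialModule Fq = (specialModule Fq : Set (CRing Fq)) + constTorsion Fq :=
  ⟨fun s _ => exists_polynomial_eq_specialSeries (aeval_theta_injective Fq) s,
    (sqrtSpecialModule_subset_add_constTorsion Fq).antisymm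
      (add_constTorsion_subset_sqrtSpecialModule Fq)⟩
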